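/- **Setting.** Let $\mathcal Z,\mathcal V$ be real Hilbert spaces and $\mathcal X$ a real Banach space with continuous embeddings $\mathcal Z\hookrightarrow\mathcal V\hookrightarrow\mathcal X$, the first one being compact and dense; let $T>0$. Let $$\mathcal I(t,z)=\tfrac12\langle Az,z\rangle+\mathcal F(z)-\langle\ell(t),z\rangle,\qquad t\in[0,T],\ z\in\mathcal Z,$$ where $A\in\mathcal L(\mathcal Z,\mathcal Z^*)$ is self-adjoint and coercive ($\langle Az,z\rangle\ge\alpha\|z\|_{\mathcal Z}^2$ with $\alpha>0$), $\ell\in C^{0,1}([0,T];\mathcal V^*)$, and $\mathcal F\in C^2(\mathcal Z;\mathbb R)$, $\mathcal F\ge0$, with $D_z\mathcal F\in C^1(\mathcal Z;\mathcal V^*)$ and $\|D_z^2\mathcal F(z)v\|_{\mathcal V^*}\le C_{\mathcal F}(1+\|z\|_{\mathcal Z}^q)\|v\|_{\mathcal Z}$ for some $q\ge1$. Assume that for every $r>0$ there is $C(r)\ge0$ with $\langle[D_z^2\mathcal I(t,z_1)-D_z^2\mathcal I(t,z_2)]v,v\rangle\le C(r)\|z_1-z_2\|_{\mathcal Z}\|v\|_{\mathcal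 Z}^2$ for all $t\in[0,T]$, all $v\in\mathcal Z$ and all $z_1,z_2\in\mathcal Z$ of norm less than $r$. Let $\mathcal R:\mathcal V\to[0,\infty)$ be lower semicontinuous, convex and positively homogeneous of degree one, with $\underline\rho\|v\|_{\mathcal X}\le\mathcal R(v)\le\overline\rho\|v\|_{\mathcal V}$ for constants $\underline\rho,\overline\rho>0$. Call $z\in\mathcal Z$ *locally stable at time $t$* if $0\in\partial\mathcal R(0)+D_z\mathcal I(t,z)$, and let $z_0\in\mathcal Z$ be locally stable at time $0$. A *differential solution* is a function $z\in W^{1,1}(0,T;\mathcal Z)$ with $z(0)=z_0$ and $0\in\partial\mathcal R(z'(t))+D_z\mathcal I(t,z(t))$ for almost all $t\in[0,T]$. **Scheme.** For $\tau>0$ put $t_0=0$, start with the given $z_0$, and for $k\ge1$ choose $$z_k\in\operatorname{argmin}\{\mathcal I(t_{k-1},z)+\mathcal R(z-z_{k-1}) : z\in\mathcal Z,\ \|z-z_{k-1}\|_{\mathcal V}\le\tau\},\qquad t_k=\min\{t_{k-1}+\tau-\|z_k-z_{k-1}\|_{\mathcal V},\,T\}.$$ Let $N(\tau)$ be the first index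 with $t_{N(\tau)}=T$, let $\hat N(\tau)$ be the first index greater than $N(\tau)$ whose iterate is locally stable at time $T$, and let $\mathfrak k(0)<\mathfrak k(1)<\dots<\mathfrak k(J)$ enumerate the set $\{k\in\{1,\dots,N(\tau)\}: t_k>t_{k-1}\}\cup\{0,\hat N(\tau)\}$. For $1\le j\le J-1$ and $t\in[t_{\mathfrak k(j-1)},t_{\mathfrak k(j)})$ set $$\tilde z_\tau(t)=z_{\mathfrak k(j)}+\frac{t-t_{\mathfrak k(j-1)}}{t_{\mathfrak k(j)}-t_{\mathfrak k(j-1)}}\,\bigl(z_{\mathfrak k(j+1)}-z_{\mathfrak k(j)}\bigr),\qquad \tilde z_\tau(T)=z_{\hat N(\tau)}.$$ **Theorem 3.15.** Assume that $\mathcal I$ is $\kappa$-uniformly convex for some $\kappa>0$, i.e. $\langle D_z^2\mathcal I(t,z)v,v\rangle\ge\kappa\|v\|_{\mathcal Z}^2$ for all $t\in[0,T]$ and $z,v\in\mathcal Z$ (there is no smallness assumption on the Lipschitz constant of $\ell$). Then there is a unique differential solution $z$, and $z\in C^{0,1}([0,T];\mathcal Z)$. For every $\tau>0$ the scheme has iterates,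 and there are constants $C>0$ and $M\in\mathbb N$, independent of $\tau$, such that for every $\tau>0$ and all iterates of the scheme the indices $N(\tau)$ and $\hat N(\tau)$ exist (are finite), stalls last a bounded number of steps, namely $\mathfrak k(j)-\mathfrak k(j-1)\le M$ for $j=1,\dots,J$, and $$\|z(t)-\tilde z_\tau(t)\|_{\mathcal Z}\le C\sqrt\tau\qquad\text{for all } t\in[0,T].$$ -/

import Mathlib

open Set MeasureTheory
open scoped NNReal

noncomputable section

/-- The convex subdifferential of `f : V → ℝ` at `v`, a set of functionals in `V*`. -/
def convexSubdifferential {V : Type*} [NormedAddCommGroup V] [NormedSpace ℝ V]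
    (f : V → ℝ) (v : V) : Set (StrongDual ℝ V) :=
  {ξ | ∀ w : V, f v + ξ (w - v) ≤ f w}

/-- The data of a rate-independent system with semilinear energy. The laws that these data have to
satisfy are collected in `RateIndependentSystem.Assumptions`. -/
structure RateIndependentSystem (Z V X : Type*)
    [NormedAddCommGroup Z] [InnerProductSpace ℝ Z]
    [NormedAddCommGroup V] [InnerProductSpace ℝ V]
    [NormedAddCommGroup X] [NormedSpace ℝ X] where
  /-- the embedding of `Z` into `V` -/
  ι : Z →L[ℝ] V
  /-- the embedding of `V` into `X` -/
  j : V →L[ℝ] X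
  /-- the final time -/
  T : ℝ
  /-- the operator `A : Z → Z*` of the quadratic part of the energy -/
  A : Z →L[ℝ] StrongDual ℝ Z
  /-- the non-quadratic part of the energy -/
  F : Z → ℝ
  /-- the load (only its values on `[0,T]` matter) -/
  ℓ : ℝ → StrongDual ℝ V
  /-- the dissipation potential -/
  R : V → ℝ
  /-- the initial state -/
  z₀ : Z

namespace RateIndependentSystem

variable {Z V X : Type*}
  [NormedAddCommGroup Z] [InnerProductSpace ℝ Z]
  [NormedAddCommGroup V] [InnerProductSpace ℝ V]
  [NormedAddCommGroup X] [NormedSpace ℝ X]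

/-- The energy `I(t,z) = ½⟨Az,z⟩ + F(z) - ⟨ℓ(t),z⟩`. -/
def energy (S : RateIndependentSystem Z V X) (t : ℝ) (z : Z) : ℝ :=
  1 / 2 * S.A z z + S.F z - S.ℓ t (S.ι z)

/-- The derivative `D_z I(t,z) ∈ Z*`. -/
def dEnergy (S : RateIndependentSystem Z V X) (t : ℝ) (z : Z) : StrongDual ℝ Z :=
  fderiv ℝ (S.energy t) z

/-- The second derivative `D_z² I(t,z) : Z → Z*`. -/
def ddEnergy (S : RateIndependentSystem Z V X) (t : ℝ) (z : Z) : Z →L[ℝ] StrongDual ℝ Z :=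
  fderiv ℝ (S.dEnergy t) z

/-- The inclusion `0 ∈ ∂R(v) + D_z I(t,z)` in `Z*`, where functionals on `V` are restricted
to `Z`. -/
def Inclusion (S : RateIndependentSystem Z V X) (v : V) (t : ℝ) (z : Z) : Prop :=
  ∃ ξ ∈ convexSubdifferential S.R v, ξ.comp S.ι + S.dEnergy t z = 0

/-- The state `z` is locally stable at time `t`: `0 ∈ ∂R(0) + D_z I(t,z)`. -/
def LocallyStable (S : RateIndependentSystem Z V X) (t : ℝ) (z : Z) : Prop :=
  S.Inclusion 0 t z

/-- The standing assumptions on the data. -/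
structure Assumptions (S : RateIndependentSystem Z V X) : Prop where
  ι_injective : Function.Injective S.ι
  ι_denseRange : DenseRange S.ι
  ι_compact : IsCompactOperator S.ι
  j_injective : Function.Injective S.j
  T_pos : 0 < S.T
  A_selfAdjoint : ∀ z w : Z, S.A z w = S.A w z
  A_coercive : ∃ α : ℝ, 0 < α ∧ ∀ z : Z, α * ‖z‖ ^ 2 ≤ S.A z z
  ℓ_lipschitz : ∃ L : ℝ≥0, LipschitzOnWith L S.ℓ (Icc 0 S.T)
  F_contDiff : ContDiff ℝ 2 S.F
  F_nonneg : ∀ z : Z, 0 ≤ S.F z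
  /-- `D_z F ∈ C¹(Z;V*)`, with polynomial growth of `D_z² F(z)` as an operator `Z → V*` -/
  F_lowerOrder : ∃ dF : Z → StrongDual ℝ V, ContDiff ℝ 1 dF ∧
    (∀ z v : Z, fderiv ℝ S.F z v = dF z (S.ι v)) ∧
    ∃ q : ℝ, 1 ≤ q ∧ ∃ C : ℝ, ∀ z v : Z, ‖fderiv ℝ dF z v‖ ≤ C * (1 + ‖z‖ ^ q) * ‖v‖
  /-- `I(t,·) ∈ C^{2,1}_loc(Z;ℝ)` -/
  energy_locLipschitz : ∀ r : ℝ, 0 < r → ∃ C : ℝ, 0 ≤ C ∧ ∀ t ∈ Icc 0 S.T,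
    ∀ z₁ ∈ Metric.ball (0 : Z) r, ∀ z₂ ∈ Metric.ball (0 : Z) r, ∀ v : Z,
      (S.ddEnergy t z₁ - S.ddEnergy t z₂) v v ≤ C * ‖z₁ - z₂‖ * ‖v‖ ^ 2
  R_nonneg : ∀ v : V, 0 ≤ S.R v
  R_lowerSemicontinuous : LowerSemicontinuous S.R
  R_convex : ConvexOn ℝ univ S.R
  R_posHomogeneous : ∀ c : ℝ, 0 < c → ∀ v : V, S.R (c • v) = c * S.R v
  R_bounds : ∃ ρ₁ ρ₂ : ℝ, 0 < ρ₁ ∧ 0 < ρ₂ ∧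
    ∀ v : V, ρ₁ * ‖S.j v‖ ≤ S.R v ∧ S.R v ≤ ρ₂ * ‖v‖
  z₀_stable : S.LocallyStable 0 S.z₀

/-- Global `κ`-uniform convexity of the energy for some `κ > 0`. -/
def UniformlyConvex (S : RateIndependentSystem Z V X) : Prop :=
  ∃ κ : ℝ, 0 < κ ∧ ∀ t ∈ Icc 0 S.T, ∀ z v : Z, κ * ‖v‖ ^ 2 ≤ S.ddEnergy t z v v

/-- Differential solutions: `z ∈ W^{1,1}(0,T;Z)`, i.e. (its continuous representative) is the
primitive of an integrable function `g`, which is the derivative `z'`; moreover `z(0) = z₀` and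
`0 ∈ ∂R(z'(t)) + D_z I(t,z(t))` for almost all `t ∈ [0,T]`. -/
def IsDifferentialSolution (S : RateIndependentSystem Z V X) (z : ℝ → Z) : Prop :=
  z 0 = S.z₀ ∧ ∃ g : ℝ → Z, IntervalIntegrable g volume 0 S.T ∧
    (∀ t ∈ Icc 0 S.T, z t = z 0 + ∫ s in (0 : ℝ)..t, g s) ∧
    ∀ᵐ t ∂(volume.restrict (Icc 0 S.T)), S.Inclusion (S.ι (g t)) t (z t)

/-- `(t_k, z_k)` is generated by the local incremental minimization scheme with step size `τ`. The
iteration goes on after the final time has been reached (then `t_k = T`). -/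
structure IsLocalMinScheme (S : RateIndependentSystem Z V X) (τ : ℝ) (t : ℕ → ℝ) (z : ℕ → Z) :
    Prop where
  t_zero : t 0 = 0
  z_zero : z 0 = S.z₀
  feasible : ∀ k, ‖S.ι (z (k + 1) - z k)‖ ≤ τ
  minimal : ∀ k, ∀ w : Z, ‖S.ι (w - z k)‖ ≤ τ →
    S.energy (t k) (z (k + 1)) + S.R (S.ι (z (k + 1) - z k)) ≤
      S.energy (t k) w + S.R (S.ι (w - z k))
  t_succ : ∀ k, t (k + 1) = min (t k + τ - ‖S.ι (z (k + 1) - z k)‖) S.T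

/-- `N(τ)`: the first index with `t_k = T`. -/
def endIndex (S : RateIndependentSystem Z V X) (t : ℕ → ℝ) : ℕ :=
  sInf {k | t k = S.T}

/-- `N̂(τ)`: the first index after `N(τ)` whose iterate is locally stable at time `T`. -/
def stableEndIndex (S : RateIndependentSystem Z V X) (t : ℕ → ℝ) (z : ℕ → Z) : ℕ :=
  sInf {k | S.endIndex t < k ∧ S.LocallyStable S.T (z k)}

/-- The set of the indices `k ∈ {1,…,N(τ)}` with time progress, together with `0` and `N̂(τ)`. -/
def progressIndices (S : RateIndependentSystem Z V X) (t : ℕ → ℝ) (z : ℕ → Z) : Set ℕ :=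
  {k | k ∈ Icc 1 (S.endIndex t) ∧ 0 < t k - t (k - 1)} ∪ {0, S.stableEndIndex t z}

/-- The increasing enumeration `𝔨(0) < 𝔨(1) < …` of `progressIndices`. -/
def progressIndex (S : RateIndependentSystem Z V X) (t : ℕ → ℝ) (z : ℕ → Z) (i : ℕ) : ℕ :=
  Nat.nth (fun k => k ∈ S.progressIndices t z) i

/-- For `s ∈ [0,T)`, the index `i` with `s ∈ [t_{𝔨(i-1)}, t_{𝔨(i)})`. -/
def intervalIndex (S : RateIndependentSystem Z V X) (t : ℕ → ℝ) (z : ℕ → Z) (s : ℝ) : ℕ :=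
  sInf {i | s < t (S.progressIndex t z i)}

/-- The affine interpolant that skips the iterates without time progress: on
`[t_{𝔨(i-1)}, t_{𝔨(i)})` it is
`z_{𝔨(i)} + (s - t_{𝔨(i-1)}) / (t_{𝔨(i)} - t_{𝔨(i-1)}) (z_{𝔨(i+1)} - z_{𝔨(i)})`,
and at `T` it is `z_{N̂(τ)}`. -/
def interpolant (S : RateIndependentSystem Z V X) (t : ℕ → ℝ) (z : ℕ → Z) (s : ℝ) : Z :=
  let 𝔨 := S.progressIndex t z
  let i := S.intervalIndex t z s
  if s < S.T then
    z (𝔨 i) + ((s - t (𝔨 (i - 1))) / (t (𝔨 i) - t (𝔨 (i - 1)))) • (z (𝔨 (i + 1)) - z (𝔨 i))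
  else z (S.stableEndIndex t z)

end RateIndependentSystem

end

/-! Everything is phrased through increments. The inclusion `0 ∈ ∂R(z') + D_z I` is equivalent to
two tested conditions: local stability, `0 ≤ D_z I(w) + R(w)` for all `w`, and the dissipation
inequality `D_z I(z') + R(z') ≤ 0`. An `ε`-approximate solution (`IsApproxSolution`) satisfies both
up to `ε`, with `R` and `D_z I` evaluated on increments instead of derivatives.

The core is `Regular.exists_comparison`. For approximate solutions `y` and `w`, the Bregman distance
`D = I(y) - I(w) - D_z I(w)(y - w)` dominates `κ/2 ‖y - w‖²`. Stability of each curve, tested with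
the increments of the other, together with both dissipation inequalities bounds the increments of
`D`. Symmetry of the second derivative cancels the first-order cross terms. The remaining cubic term
is of size `‖y - w‖² ‖dw‖`, which is at most a constant times `D dt` if `w` is Lipschitz. Gronwall
gives `‖y - w‖² ≤ C (ε₁ + ε₂)`, with a constant that depends on the total variation bounds. This
yields uniqueness (no errors), existence (approximations form a Cauchy sequence) and the rate `√τ`
(error of order `τ`).

It remains to see that the interpolant of the scheme is a Lipschitz approximate solution with error
of order `τ`. Let `λ_k` be the multiplier of the constraint `‖z_k - z_{k-1}‖_V ≤ τ`. Convexity gives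
`λ_{k+1} + (κ/c²) ‖z_{k+1} - z_k‖_V ≤ λ_k + L (t_k - t_{k-1})` (`multiplier_succ_le`). A stall
starts with `λ = 0` and with a load increment of at most `L τ`. Each step of full length `τ` uses up
`κ τ/c²` of it, so a stall has at most about `L c²/κ` steps; a large `L` only makes it longer. Its
total displacement is bounded by a multiple of the time progress just before it. Hence the
interpolant, which pairs the stall after `t_{𝔨(i)}` with the interval ending there, has a Lipschitz
constant independent of `τ`. -/

section SymmetricForms

/-! ### Symmetric forms and convex calculus. -/

variable {E : Type*} [NormedAddCommGroup E] [NormedSpace ℝ E]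

/-- A symmetric bilinear form is bounded by its quadratic form. -/
theorem ContinuousLinearMap.norm_le_of_abs_apply_self_le (H : E →L[ℝ] StrongDual ℝ E)
    (hsymm : ∀ u v, H u v = H v u) {K : ℝ} (hK : 0 ≤ K) (h : ∀ v, |H v v| ≤ K * ‖v‖ ^ 2) :
    ‖H‖ ≤ 2 * K := by
  have polar : ∀ u v : E, ‖u‖ ≤ 1 → ‖v‖ ≤ 1 → |H u v| ≤ 2 * K := by
    intro u v hu hv
    have e : H u v = (H (u + v) (u + v) - H u u - H v v) / 2 := by
      simp only [map_add, add_apply]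
      rw [hsymm v u]; ring
    have e' : H u v = (H u u + H v v - H (u - v) (u - v)) / 2 := by
      simp only [map_sub, sub_apply]
      rw [hsymm v u]; ring
    -- Polarization: for `u`, `v` in the unit ball the triangle inequality gives `‖u ± v‖² ≤ 4`,
    -- hence `(4K + 4K) / 4 = 2K`.
    have e4 : H u v = (H (u + v) (u + v) - H (u - v) (u - v)) / 4 := by linarith
    have n1 : ‖u + v‖ ^ 2 ≤ 4 := by
      have := norm_add_le u v
      nlinarith [norm_nonneg (u + v)]
    have n2 : ‖u - v‖ ^ 2 ≤ 4 := by
      have := norm_sub_le u v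
      nlinarith [norm_nonneg (u - v)]
    have h1 := h (u + v)
    have h2 := h (u - v)
    rw [abs_le] at h1 h2 ⊢
    have := mul_le_mul_of_nonneg_left n1 hK
    have := mul_le_mul_of_nonneg_left n2 hK
    constructor <;> linarith
  refine H.opNorm_le_of_unit_norm (by positivity) fun u hu => ?_
  refine (H u).opNorm_le_of_unit_norm (by positivity) fun v hv => ?_
  exact polar u v hu.le hv.le

end SymmetricForms

section ConvexCalculus

variable {E : Type*} [NormedAddCommGroup E] [NormedSpace ℝ E]

/-- A field whose derivative is bounded below by `κ` is `κ`-strongly monotone. -/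
theorem strongly_monotone_of_fderiv {P : E → StrongDual ℝ E} {H : E → E →L[ℝ] StrongDual ℝ E}
    (hP : ∀ z, HasFDerivAt P (H z) z) {κ : ℝ} (hH : ∀ z v, κ * ‖v‖ ^ 2 ≤ H z v v) (x y : E) :
    κ * ‖x - y‖ ^ 2 ≤ P x (x - y) - P y (x - y) := by
  set v := x - y with hv
  have hd : ∀ s : ℝ, HasDerivAt (fun s : ℝ => P (y + s • v) v) (H (y + s • v) v v) s := by
    intro s
    have h1 : HasDerivAt (fun s : ℝ => y + s • v) v s := by
      simpa using ((hasDerivAt_id s).smul_const v).const_add y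
    have h2 := (hP (y + s • v)).comp_hasDerivAt s h1
    exact (((ContinuousLinearMap.apply ℝ ℝ v).hasFDerivAt).comp_hasDerivAt s h2)
  obtain ⟨s, -, hs⟩ := exists_hasDerivAt_eq_slope (fun s : ℝ => P (y + s • v) v)
    (fun s => H (y + s • v) v v) zero_lt_one
    (fun s _ => (hd s).continuousAt.continuousWithinAt) (fun s _ => hd s)
  have h := hH (y + s • v) v
  rw [hs] at h
  have hxy : y + v = x := by rw [hv]; abel
  simpa [hxy] using h

/-- A function whose derivative is `κ`-strongly monotone lies above its tangents. -/
theorem tangent_le_of_strongly_monotone {f : E → ℝ} {P : E → StrongDual ℝ E}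
    (hf : ∀ z, HasFDerivAt f (P z) z) {κ : ℝ}
    (hP : ∀ x y, κ * ‖x - y‖ ^ 2 ≤ P x (x - y) - P y (x - y)) (x y : E) :
    f x + P x (y - x) + κ / 2 * ‖y - x‖ ^ 2 ≤ f y := by
  set v := y - x with hv
  let g : ℝ → ℝ := fun s => f (x + s • v) - s * P x v - κ / 2 * s ^ 2 * ‖v‖ ^ 2
  have hd : ∀ s : ℝ, HasDerivAt g (P (x + s • v) v - P x v - κ * s * ‖v‖ ^ 2) s := by
    intro s
    have h1 : HasDerivAt (fun s : ℝ => x + s • v) v s := by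
      simpa using ((hasDerivAt_id s).smul_const v).const_add x
    have h2 := (hf (x + s • v)).comp_hasDerivAt s h1
    have h3 := (h2.sub ((hasDerivAt_id s).mul_const (P x v))).sub
      ((((hasDerivAt_id s).pow 2).const_mul (κ / 2)).mul_const (‖v‖ ^ 2))
    refine h3.congr_deriv ?_
    simp only [id, one_mul]
    ring
  have hmono : MonotoneOn g (Icc 0 1) := by
    refine monotoneOn_of_deriv_nonneg (convex_Icc 0 1)
      (fun s _ => (hd s).continuousAt.continuousWithinAt)
      (fun s _ => (hd s).differentiableAt.differentiableWithinAt) fun s hs => ?_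
    rw [interior_Icc] at hs
    rw [(hd s).deriv]
    -- Monotonicity between `x + s • v` and `x` controls `s` times the derivative of `g`; then
    -- divide by `s > 0`.
    have h := hP (x + s • v) x
    simp only [add_sub_cancel_left, map_smul, smul_eq_mul, norm_smul, Real.norm_eq_abs, mul_pow,
      sq_abs] at h
    have : 0 ≤ s * (P (x + s • v) v - P x v - κ * s * ‖v‖ ^ 2) := by
      calc (0 : ℝ) ≤ _ := sub_nonneg.2 h
        _ = _ := by ring
    exact nonneg_of_mul_nonneg_right this hs.1
  have h := hmono (left_mem_Icc.2 zero_le_one) (right_mem_Icc.2 zero_le_one) zero_le_one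
  have hxy : x + v = y := by rw [hv]; abel
  simp only [g, zero_smul, add_zero, one_smul, hxy] at h
  linarith

end ConvexCalculus

/-! ### The tested form of the inclusion and the quantitative properties of the data. -/

namespace RateIndependentSystem

variable {Z V X : Type*}
  [NormedAddCommGroup Z] [InnerProductSpace ℝ Z]
  [NormedAddCommGroup V] [InnerProductSpace ℝ V]
  [NormedAddCommGroup X] [NormedSpace ℝ X]

/-- The dissipation potential restricted to `Z`. -/
def diss (S : RateIndependentSystem Z V X) (w : Z) : ℝ := S.R (S.ι w)

theorem Assumptions.R_zero {S : RateIndependentSystem Z V X} (hS : S.Assumptions) : S.R 0 = 0 := by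
  obtain ⟨ρ₁, ρ₂, -, -, h⟩ := hS.R_bounds
  refine le_antisymm ?_ (hS.R_nonneg 0)
  simpa using (h 0).2

theorem Assumptions.R_add_le {S : RateIndependentSystem Z V X} (hS : S.Assumptions) (v w : V) :
    S.R (v + w) ≤ S.R v + S.R w := by
  have h := hS.R_convex.2 (mem_univ v) (mem_univ w) (show (0 : ℝ) ≤ 1 / 2 by norm_num)
    (show (0 : ℝ) ≤ 1 / 2 by norm_num) (by norm_num)
  rw [← smul_add, hS.R_posHomogeneous _ (by norm_num)] at h
  simp only [smul_eq_mul] at h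
  linarith

theorem Assumptions.R_smul {S : RateIndependentSystem Z V X} (hS : S.Assumptions) {a : ℝ}
    (ha : 0 ≤ a) (v : V) : S.R (a • v) = a * S.R v := by
  rcases ha.eq_or_lt with rfl | ha
  · simp [hS.R_zero]
  · exact hS.R_posHomogeneous a ha v

/-- The differential inclusion, tested with elements of `Z`. -/
theorem Assumptions.inclusion_iff {S : RateIndependentSystem Z V X} (hS : S.Assumptions)
    (g z : Z) (t : ℝ) : S.Inclusion (S.ι g) t z ↔
      (∀ w, 0 ≤ S.dEnergy t z w + S.diss w) ∧ S.dEnergy t z g + S.diss g ≤ 0 := by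
  constructor
  · rintro ⟨ξ, hξ, h⟩
    have e : ∀ w, S.dEnergy t z w = -ξ (S.ι w) := fun w => by
      have := congrArg (fun f : StrongDual ℝ Z => f w) h
      simp only [add_apply, ContinuousLinearMap.comp_apply,
        zero_apply] at this
      linarith
    constructor
    · intro w
      -- By homogeneity `ξ ∈ ∂R(v)` means `ξ ≤ R` and `R v ≤ ξ v`: the first follows by testing at
      -- `v + w` with subadditivity, the second by testing at `0`.
      have h1 := hξ (S.ι g + S.ι w)
      rw [add_sub_cancel_left] at h1
      have h2 := hS.R_add_le (S.ι g) (S.ι w)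
      rw [e w, diss]
      linarith
    · have h1 := hξ 0
      rw [hS.R_zero, zero_sub, map_neg] at h1
      rw [e g, diss]
      linarith
  · rintro ⟨h1, h2⟩
    obtain ⟨ρ₁, ρ₂, -, hρ₂, hR⟩ := hS.R_bounds
    -- Hahn–Banach: `-D_z I`, read as a functional on the range of `ι`, lies below the sublinear `R`
    -- and extends to `V` below `R`. The bound `R ≤ ρ₂ ‖·‖` makes the extension continuous.
    let e := LinearEquiv.ofInjective (S.ι : Z →ₗ[ℝ] V) hS.ι_injective
    let f : V →ₗ.[ℝ] ℝ :=
      { domain := LinearMap.range (S.ι : Z →ₗ[ℝ] V)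
        toFun := -((S.dEnergy t z : Z →ₗ[ℝ] ℝ).comp (e.symm : _ →ₗ[ℝ] Z)) }
    have hf : ∀ x : f.domain, f x ≤ S.R x := by
      intro x
      obtain ⟨w, rfl⟩ := e.surjective x
      have : f (e w) = -S.dEnergy t z w := by
        change -(S.dEnergy t z (e.symm (e w))) = _
        rw [e.symm_apply_apply]
      rw [this]
      have h3 := h1 w
      have h4 : ((e w : LinearMap.range (S.ι : Z →ₗ[ℝ] V)) : V) = S.ι w := rfl
      rw [h4]
      simp only [diss] at h3
      linarith
    obtain ⟨φ, hφ, hφR⟩ := exists_extension_of_le_sublinear f S.R hS.R_posHomogeneous hS.R_add_le hf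
    have hφι : ∀ w, φ (S.ι w) = -S.dEnergy t z w := fun w => by
      have h3 := hφ (e w)
      have h4 : f (e w) = -S.dEnergy t z w := by
        change -(S.dEnergy t z (e.symm (e w))) = _
        rw [e.symm_apply_apply]
      exact h3.trans h4
    have hb : ∀ v, ‖φ v‖ ≤ ρ₂ * ‖v‖ := fun v => by
      rw [Real.norm_eq_abs, abs_le]
      have h3 := (hφR v).trans (hR v).2
      have h4 := (hφR (-v)).trans (hR (-v)).2
      rw [map_neg, norm_neg] at h4
      constructor <;> linarith
    refine ⟨φ.mkContinuous ρ₂ hb, fun w => ?_, ?_⟩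
    · simp only [LinearMap.mkContinuous_apply, map_sub]
      rw [hφι g]
      have h3 := hφR w
      simp only [diss] at h2
      linarith
    · ext w
      simp [hφι]

theorem Assumptions.locallyStable_iff {S : RateIndependentSystem Z V X} (hS : S.Assumptions)
    (z : Z) (t : ℝ) : S.LocallyStable t z ↔ ∀ w, 0 ≤ S.dEnergy t z w + S.diss w := by
  have h := hS.inclusion_iff 0 z t
  rw [map_zero] at h
  rw [LocallyStable, h]
  refine and_iff_left ?_
  simp [diss, hS.R_zero]

theorem energy_eq (S : RateIndependentSystem Z V X) (s t : ℝ) (z : Z) :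
    S.energy t z = S.energy s z - (S.ℓ t - S.ℓ s) (S.ι z) := by
  simp only [energy, sub_apply]
  ring

theorem Assumptions.contDiff_energy {S : RateIndependentSystem Z V X} (hS : S.Assumptions)
    (t : ℝ) : ContDiff ℝ 2 (S.energy t) := by
  have h1 : ContDiff ℝ 2 fun z => S.A z z := S.A.contDiff.clm_apply contDiff_id
  exact ((contDiff_const.mul h1).add hS.F_contDiff).sub ((S.ℓ t).contDiff.comp S.ι.contDiff)

theorem Assumptions.hasFDerivAt_energy {S : RateIndependentSystem Z V X} (hS : S.Assumptions)
    (t : ℝ) (z : Z) : HasFDerivAt (S.energy t) (S.dEnergy t z) z :=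
  ((hS.contDiff_energy t).differentiable (by norm_num) z).hasFDerivAt

theorem Assumptions.hasFDerivAt_dEnergy {S : RateIndependentSystem Z V X} (hS : S.Assumptions)
    (t : ℝ) (z : Z) : HasFDerivAt (S.dEnergy t) (S.ddEnergy t z) z := by
  have h : ContDiff ℝ 1 (S.dEnergy t) := (hS.contDiff_energy t).fderiv_right (by norm_num)
  exact (h.differentiable (by norm_num) z).hasFDerivAt

theorem Assumptions.ddEnergy_symm {S : RateIndependentSystem Z V X} (hS : S.Assumptions)
    (t : ℝ) (z u v : Z) : S.ddEnergy t z u v = S.ddEnergy t z v u := by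
  have h := (hS.contDiff_energy t).contDiffAt (x := z) |>.isSymmSndFDerivAt
    (by rw [minSmoothness_of_isRCLikeNormedField])
  exact h u v

theorem Assumptions.dEnergy_eq {S : RateIndependentSystem Z V X} (hS : S.Assumptions)
    (s t : ℝ) (z : Z) : S.dEnergy t z = S.dEnergy s z - (S.ℓ t - S.ℓ s).comp S.ι := by
  refine (hS.hasFDerivAt_energy t z).unique ?_
  have h := (hS.hasFDerivAt_energy s z).sub ((S.ℓ t - S.ℓ s).comp S.ι).hasFDerivAt
  have e : S.energy t = S.energy s - ⇑((S.ℓ t - S.ℓ s).comp S.ι) :=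
    funext fun z => S.energy_eq s t z
  rw [e]; exact h

/-- On balls the second derivative of the energy is Lipschitz continuous in operator norm. -/
theorem Assumptions.ddEnergy_lipschitz {S : RateIndependentSystem Z V X} (hS : S.Assumptions)
    (b : ℝ) : ∃ C : ℝ, 0 ≤ C ∧ ∀ x ∈ Metric.closedBall (0 : Z) b, ∀ y ∈ Metric.closedBall (0 : Z) b,
      ‖S.ddEnergy 0 x - S.ddEnergy 0 y‖ ≤ C * ‖x - y‖ := by
  obtain ⟨C, hC, h⟩ := hS.energy_locLipschitz (|b| + 1) (by positivity)
  refine ⟨2 * C, by positivity, fun x hx y hy => ?_⟩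
  have sub : Metric.closedBall (0 : Z) b ⊆ Metric.ball 0 (|b| + 1) :=
    Metric.closedBall_subset_ball (by linarith [le_abs_self b])
  have h0 : (0 : ℝ) ∈ Icc 0 S.T := ⟨le_rfl, hS.T_pos.le⟩
  rw [mul_assoc]
  refine ContinuousLinearMap.norm_le_of_abs_apply_self_le _ (fun u v => ?_) (by positivity)
    fun v => ?_
  · simp only [sub_apply]
    rw [hS.ddEnergy_symm 0 x, hS.ddEnergy_symm 0 y]
  -- The assumption is one-sided; exchanging the two points makes it two-sided.
  · have h1 := h 0 h0 x (sub hx) y (sub hy) v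
    have h2 := h 0 h0 y (sub hy) x (sub hx) v
    rw [norm_sub_rev y x] at h2
    simp only [sub_apply] at h1 h2 ⊢
    rw [abs_le]
    constructor <;> linarith

/-- The quantitative properties of a uniformly convex rate-independent system on which the
analysis is based; the force `D_z I` is tested with elements of `Z` throughout. -/
structure Regular (S : RateIndependentSystem Z V X) (κ L ρ c : ℝ) : Prop where
  κ_pos : 0 < κ
  L_nonneg : 0 ≤ L
  ρ_nonneg : 0 ≤ ρ
  c_pos : 0 < c
  T_pos : 0 < S.T
  ι_injective : Function.Injective S.ι
  norm_ι_le : ∀ w, ‖S.ι w‖ ≤ c * ‖w‖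
  hasFDerivAt : ∀ t z, HasFDerivAt (S.energy t) (S.dEnergy t z) z
  continuous_dEnergy : Continuous (S.dEnergy 0)
  continuousOn_load : ContinuousOn S.ℓ (Icc 0 S.T)
  dEnergy_apply : ∀ s t z w, S.dEnergy t z w = S.dEnergy s z w - (S.ℓ t - S.ℓ s) (S.ι w)
  load_le : ∀ s ∈ Icc 0 S.T, ∀ t ∈ Icc 0 S.T, ∀ w,
    |(S.ℓ t - S.ℓ s) (S.ι w)| ≤ L * |t - s| * ‖S.ι w‖
  monotone : ∀ t x y, κ * ‖x - y‖ ^ 2 ≤ S.dEnergy t x (x - y) - S.dEnergy t y (x - y)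
  lipschitz : ∀ b : ℝ, ∃ Λ : ℝ, 0 ≤ Λ ∧ ∀ x ∈ Metric.closedBall (0 : Z) b,
    ∀ y ∈ Metric.closedBall (0 : Z) b, ∀ t v,
      |S.dEnergy t x v - S.dEnergy t y v| ≤ Λ * ‖x - y‖ * ‖v‖
  taylor : ∀ b : ℝ, ∃ Λ : ℝ, 0 ≤ Λ ∧ ∀ x ∈ Metric.closedBall (0 : Z) b,
    ∀ x' ∈ Metric.closedBall (0 : Z) b, ∀ y ∈ Metric.closedBall (0 : Z) b, ∀ t,
      |(S.dEnergy t x' (x - y) - S.dEnergy t x (x - y)) -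
        (S.dEnergy t x (x' - x) - S.dEnergy t y (x' - x))| ≤
        Λ * (‖x' - x‖ ^ 2 * ‖x - y‖ + ‖x - y‖ ^ 2 * ‖x' - x‖)
  diss_nonneg : ∀ w, 0 ≤ S.diss w
  diss_add_le : ∀ v w, S.diss (v + w) ≤ S.diss v + S.diss w
  diss_smul : ∀ a : ℝ, 0 ≤ a → ∀ w, S.diss (a • w) = a * S.diss w
  diss_le : ∀ w, S.diss w ≤ ρ * ‖S.ι w‖
  initial_stable : ∀ w, 0 ≤ S.dEnergy 0 S.z₀ w + S.diss w

/-- The load enters linearly, so differences of `D_z I(t,·)` at a fixed time do not depend on `t`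
(`diff`). All estimates on the energy therefore reduce to time `0`. -/
theorem Assumptions.exists_regular {S : RateIndependentSystem Z V X} (hS : S.Assumptions)
    (hconv : S.UniformlyConvex) : ∃ κ L ρ c : ℝ, S.Regular κ L ρ c := by
  obtain ⟨κ, hκ, hconv⟩ := hconv
  obtain ⟨L, hL⟩ := hS.ℓ_lipschitz
  obtain ⟨ρ₁, ρ₂, -, hρ₂, hR⟩ := hS.R_bounds
  have h0 : (0 : ℝ) ∈ Icc 0 S.T := ⟨le_rfl, hS.T_pos.le⟩
  have shift : ∀ s t z w, S.dEnergy t z w = S.dEnergy s z w - (S.ℓ t - S.ℓ s) (S.ι w) := by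
    intro s t z w
    rw [hS.dEnergy_eq s t z]; rfl
  have diff : ∀ t x y w, S.dEnergy t x w - S.dEnergy t y w =
      S.dEnergy 0 x w - S.dEnergy 0 y w := by
    intro t x y w
    rw [shift 0 t x w, shift 0 t y w]; ring
  refine ⟨κ, L, ρ₂, ‖S.ι‖ + 1, ?_⟩
  refine
    { κ_pos := hκ
      L_nonneg := L.2
      ρ_nonneg := hρ₂.le
      c_pos := by positivity
      T_pos := hS.T_pos
      ι_injective := hS.ι_injective
      norm_ι_le := fun w => (S.ι.le_opNorm w).trans (by gcongr; linarith)
      hasFDerivAt := hS.hasFDerivAt_energy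
      continuous_dEnergy := (hS.contDiff_energy 0).continuous_fderiv (by norm_num)
      continuousOn_load := hL.continuousOn
      dEnergy_apply := shift
      load_le := fun s hs t ht w => ?_
      monotone := fun t x y => ?_
      lipschitz := fun b => ?_
      taylor := fun b => ?_
      diss_nonneg := fun w => hS.R_nonneg _
      diss_add_le := fun v w => by
        simp only [diss, map_add]; exact hS.R_add_le _ _
      diss_smul := fun a ha w => by
        simp only [diss, map_smul]; exact hS.R_smul ha _
      diss_le := fun w => (hR _).2
      initial_stable := (hS.locallyStable_iff _ _).1 hS.z₀_stable }
  · have h := hL.dist_le_mul t ht s hs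
    rw [dist_eq_norm, Real.dist_eq] at h
    refine ((S.ℓ t - S.ℓ s).le_opNorm _).trans ?_
    gcongr
  · rw [diff]
    exact strongly_monotone_of_fderiv (hS.hasFDerivAt_dEnergy 0) (hconv 0 h0) x y
  · obtain ⟨C, hC, h⟩ := hS.ddEnergy_lipschitz b
    refine ⟨‖S.ddEnergy 0 0‖ + C * |b|, by positivity, fun x hx y hy t v => ?_⟩
    rw [diff]
    have hb : 0 ≤ b := by
      rw [mem_closedBall_zero_iff] at hx
      exact (norm_nonneg x).trans hx
    have h1 := (convex_closedBall (0 : Z) b).norm_image_sub_le_of_norm_hasFDerivWithin_le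
      (f := S.dEnergy 0) (f' := S.ddEnergy 0) (C := ‖S.ddEnergy 0 0‖ + C * |b|)
      (fun z _ => (hS.hasFDerivAt_dEnergy 0 z).hasFDerivWithinAt) (fun z hz => ?_) hy hx
    · rw [← sub_apply]
      refine ((S.dEnergy 0 x - S.dEnergy 0 y).le_opNorm v).trans ?_
      gcongr
    · have h2 := h z hz 0 (by simpa using hb)
      rw [mem_closedBall_zero_iff] at hz
      rw [sub_zero] at h2
      have h3 : ‖S.ddEnergy 0 z‖ ≤ ‖S.ddEnergy 0 0‖ + ‖S.ddEnergy 0 z - S.ddEnergy 0 0‖ := by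
        have := norm_add_le (S.ddEnergy 0 0) (S.ddEnergy 0 z - S.ddEnergy 0 0)
        have e : S.ddEnergy 0 0 + (S.ddEnergy 0 z - S.ddEnergy 0 0) = S.ddEnergy 0 z := by
          ext; simp
        rwa [e] at this
      have h4 : C * ‖z‖ ≤ C * |b| := by
        gcongr; exact hz.trans (le_abs_self b)
      linarith
  · obtain ⟨C, hC, h⟩ := hS.ddEnergy_lipschitz b
    refine ⟨C, hC, fun x hx x' hx' y hy t => ?_⟩
    rw [diff t x' x, diff t x y]
    have key : ∀ p ∈ Metric.closedBall (0 : Z) b, ∀ q ∈ Metric.closedBall (0 : Z) b,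
        ‖S.dEnergy 0 q - S.dEnergy 0 p - S.ddEnergy 0 p (q - p)‖ ≤ C * ‖q - p‖ * ‖q - p‖ := by
      intro p hp q hq
      have hseg : segment ℝ p q ⊆ Metric.closedBall (0 : Z) b :=
        (convex_closedBall (0 : Z) b).segment_subset hp hq
      refine (convex_segment p q).norm_image_sub_le_of_norm_hasFDerivWithin_le'
        (f' := S.ddEnergy 0) (fun z _ => (hS.hasFDerivAt_dEnergy 0 z).hasFDerivWithinAt)
        (fun z hz => ?_) (left_mem_segment ℝ p q) (right_mem_segment ℝ p q)
      refine (h z (hseg hz) p hp).trans ?_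
      gcongr
      obtain ⟨θ, ⟨hθ0, hθ1⟩, rfl⟩ := (segment_eq_image' ℝ p q ▸ hz)
      rw [add_sub_cancel_left, norm_smul, Real.norm_of_nonneg hθ0]
      exact mul_le_of_le_one_left (norm_nonneg _) hθ1
    have k1 := (ContinuousLinearMap.le_opNorm _ (x - y)).trans
      (mul_le_mul_of_nonneg_right (key x hx x' hx') (norm_nonneg (x - y)))
    have k2 := (ContinuousLinearMap.le_opNorm _ (x' - x)).trans
      (mul_le_mul_of_nonneg_right (key x hx y hy) (norm_nonneg (x' - x)))
    simp only [sub_apply, Real.norm_eq_abs] at k1 k2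
    rw [norm_sub_rev y x] at k2
    -- Both differences in `taylor` have the leading term `D_z² I(x)(x' - x)(x - y)`, by symmetry;
    -- only the quadratic Taylor remainders survive.
    have e1 : S.ddEnergy 0 x (y - x) (x' - x) = -S.ddEnergy 0 x (x' - x) (x - y) := by
      rw [hS.ddEnergy_symm 0 x (y - x), ← neg_sub x y, map_neg]
    rw [e1] at k2
    rw [abs_le] at k1 k2 ⊢
    constructor <;> nlinarith [k1.1, k1.2, k2.1, k2.2]

end RateIndependentSystem

/-! ### Gronwall lemma and comparison of approximate solutions. -/

/-- A Gronwall lemma for functions whose increments are controlled on small intervals, up to an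
arbitrarily small multiple of the increments of a monotone function. -/
theorem le_exp_mul_of_small_increments {f Γ : ℝ → ℝ} {T c ε : ℝ} (hc : 0 ≤ c) (hε : 0 ≤ ε)
    (hf : 0 ≤ f 0) (hΓ : MonotoneOn Γ (Icc 0 T))
    (h : ∀ η > 0, ∃ δ > 0, ∀ s ∈ Icc 0 T, ∀ t ∈ Icc 0 T, s ≤ t → t - s ≤ δ →
      f t ≤ (1 + c * (t - s)) * f s + (ε + η) * (Γ t - Γ s)) {t : ℝ} (ht : t ∈ Icc 0 T) :
    f t ≤ Real.exp (c * t) * (f 0 + ε * (Γ t - Γ 0)) := by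
  have h0 : (0 : ℝ) ∈ Icc 0 T := ⟨le_rfl, ht.1.trans ht.2⟩
  have hB : 0 ≤ Γ t - Γ 0 := sub_nonneg.2 (hΓ h0 ht ht.1)
  have key : ∀ η > 0, f t ≤ Real.exp (c * t) * (f 0 + (ε + η) * (Γ t - Γ 0)) := by
    intro η hη
    obtain ⟨δ, hδ, hstep⟩ := h η hη
    obtain ⟨n, hn⟩ := exists_nat_gt (t / δ)
    have hn0 : (0 : ℝ) < n := (div_nonneg ht.1 hδ.le).trans_lt hn
    set d := t / n with hd
    have hd0 : 0 ≤ d := div_nonneg ht.1 hn0.le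
    have hdδ : d ≤ δ := by
      rw [hd, div_le_iff₀ hn0]
      rw [div_lt_iff₀ hδ] at hn
      linarith
    have hnd : (n : ℝ) * d = t := by rw [hd]; field_simp
    have hmem : ∀ i : ℕ, i ≤ n → (i : ℝ) * d ∈ Icc 0 T := fun i hi => by
      refine ⟨by positivity, le_trans ?_ ht.2⟩
      rw [← hnd]
      gcongr
    have ind : ∀ i : ℕ, i ≤ n →
        f (i * d) ≤ Real.exp (c * (i * d)) * (f 0 + (ε + η) * (Γ (i * d) - Γ 0)) := by
      intro i
      induction i with
      | zero => intro _; simp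
      | succ i ih =>
        intro hi
        have hi' : i ≤ n := by omega
        have e : ((i + 1 : ℕ) : ℝ) * d = i * d + d := by push_cast; ring
        have m0 := hmem i hi'
        have m1 := hmem (i + 1) hi
        rw [e] at m1 ⊢
        have hs := hstep _ m0 _ m1 (by linarith) (by linarith)
        rw [add_sub_cancel_left] at hs
        have g0 : 0 ≤ Γ (i * d) - Γ 0 := sub_nonneg.2 (hΓ h0 m0 m0.1)
        have g1 : 0 ≤ Γ (i * d + d) - Γ (i * d) := sub_nonneg.2 (hΓ m0 m1 (by linarith))
        have hX : 0 ≤ f 0 + (ε + η) * (Γ (i * d) - Γ 0) := by positivity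
        have e1 : (1 + c * d) * f (i * d) ≤
            Real.exp (c * (i * d + d)) * (f 0 + (ε + η) * (Γ (i * d) - Γ 0)) := by
          calc (1 + c * d) * f (i * d)
              ≤ (1 + c * d) *
                (Real.exp (c * (i * d)) * (f 0 + (ε + η) * (Γ (i * d) - Γ 0))) := by
                gcongr
                exact ih hi'
            _ ≤ Real.exp (c * d) *
                (Real.exp (c * (i * d)) * (f 0 + (ε + η) * (Γ (i * d) - Γ 0))) := by
                gcongr
                linarith [Real.add_one_le_exp (c * d)]
            _ = _ := by rw [← mul_assoc, ← Real.exp_add]; ring_nf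
        -- The source term is inflated by the current exponential, so that the increments of `Γ`
        -- telescope.
        have e2 : (ε + η) * (Γ (i * d + d) - Γ (i * d)) ≤
            Real.exp (c * (i * d + d)) * ((ε + η) * (Γ (i * d + d) - Γ (i * d))) := by
          refine le_mul_of_one_le_left (by positivity) (Real.one_le_exp ?_)
          exact mul_nonneg hc m1.1
        calc f (i * d + d) ≤ _ := hs
          _ ≤ _ := add_le_add e1 e2
          _ = _ := by ring
    simpa [hnd] using ind n le_rfl
  set A := Real.exp (c * t) with hA
  have hA0 : 0 < A := Real.exp_pos _
  refine le_of_forall_pos_le_add fun e he => ?_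
  have hpos : 0 < A * (Γ t - Γ 0) + 1 := by positivity
  have h1 := key (e / (A * (Γ t - Γ 0) + 1)) (by positivity)
  have h2 : A * (e / (A * (Γ t - Γ 0) + 1) * (Γ t - Γ 0)) ≤ e := by
    rw [show A * (e / (A * (Γ t - Γ 0) + 1) * (Γ t - Γ 0)) =
      (e * (A * (Γ t - Γ 0))) / (A * (Γ t - Γ 0) + 1) by ring, div_le_iff₀ hpos]
    nlinarith
  nlinarith

/-- Absorbs the errors that are quadratic in the increments `A`, `B`: one factor is below `ω = η /
(2Q)`, the other below `g` or `k`, and `Q` is chosen to exceed the total coefficient `2Λ + 2bM`. -/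
theorem quadratic_error_le {Λ M b η A B U g k : ℝ} (hΛ : 0 ≤ Λ) (hM : 0 ≤ M) (hb : 0 ≤ b)
    (hη : 0 < η) (hA : 0 ≤ A) (hB : 0 ≤ B) (hAg : A ≤ g) (hBk : B ≤ k)
    (hg : g ≤ η / (2 * (2 * Λ + 2 * b * M + 1))) (hk : k ≤ η / (2 * (2 * Λ + 2 * b * M + 1)))
    (hU : U ≤ 2 * b) :
    Λ * (A * A + B * A + B * B) + M * (B ^ 2 * U) ≤ η / 2 * (g + k) := by
  set Q := 2 * Λ + 2 * b * M + 1 with hQ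
  have hQ0 : 0 < Q := by positivity
  set ω := η / (2 * Q) with hω
  have hω0 : 0 < ω := by positivity
  have gk : 0 ≤ g + k := by linarith
  have t1 : A * A ≤ ω * g := mul_le_mul (hAg.trans hg) hAg hA hω0.le
  have t2 : B * A ≤ ω * g := mul_le_mul (hBk.trans hk) hAg hA hω0.le
  have t3 : B * B ≤ ω * k := mul_le_mul (hBk.trans hk) hBk hB hω0.le
  have t4 : 0 ≤ ω * k := mul_nonneg hω0.le (hB.trans hBk)
  have t5 : 0 ≤ ω * g := mul_nonneg hω0.le (hA.trans hAg)
  have s2 : B ^ 2 * U ≤ ω * (g + k) * (2 * b) := by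
    have : B ^ 2 ≤ ω * (g + k) := by rw [sq]; linarith
    calc B ^ 2 * U ≤ B ^ 2 * (2 * b) := by gcongr
      _ ≤ _ := by gcongr
  calc Λ * (A * A + B * A + B * B) + M * (B ^ 2 * U)
      ≤ Λ * (2 * (ω * (g + k))) + M * (ω * (g + k) * (2 * b)) := by
        gcongr
        linarith
    _ = (2 * Λ + 2 * b * M) * (ω * (g + k)) := by ring
    _ ≤ Q * (ω * (g + k)) := by gcongr; linarith
    _ = η / 2 * (g + k) := by rw [hω]; field_simp

namespace RateIndependentSystem

variable {Z V X : Type*}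
  [NormedAddCommGroup Z] [InnerProductSpace ℝ Z]
  [NormedAddCommGroup V] [InnerProductSpace ℝ V]
  [NormedAddCommGroup X] [NormedSpace ℝ X]
  {S : RateIndependentSystem Z V X} {κ L ρ c : ℝ}

namespace Regular

theorem dEnergy_sub (h : S.Regular κ L ρ c) (s t : ℝ) (x y w : Z) :
    S.dEnergy s x w - S.dEnergy s y w = S.dEnergy t x w - S.dEnergy t y w := by
  rw [h.dEnergy_apply t s x, h.dEnergy_apply t s y]; ring

theorem tangent_le (h : S.Regular κ L ρ c) (t : ℝ) (x y : Z) :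
    S.energy t x + S.dEnergy t x (y - x) + κ / 2 * ‖y - x‖ ^ 2 ≤ S.energy t y :=
  tangent_le_of_strongly_monotone (h.hasFDerivAt t) (h.monotone t) x y

theorem diss_le_norm (h : S.Regular κ L ρ c) (w : Z) : S.diss w ≤ ρ * c * ‖w‖ := by
  refine (h.diss_le w).trans ?_
  rw [mul_assoc]
  exact mul_le_mul_of_nonneg_left (h.norm_ι_le w) h.ρ_nonneg

theorem diss_zero (h : S.Regular κ L ρ c) : S.diss 0 = 0 := by
  simpa using h.diss_smul 0 le_rfl 0

theorem load_le_norm (h : S.Regular κ L ρ c) {s t : ℝ} (hs : s ∈ Icc 0 S.T) (ht : t ∈ Icc 0 S.T)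
    (w : Z) : |(S.ℓ t - S.ℓ s) (S.ι w)| ≤ L * c * |t - s| * ‖w‖ := by
  refine (h.load_le s hs t ht w).trans ?_
  have := mul_le_mul_of_nonneg_left (h.norm_ι_le w) (mul_nonneg h.L_nonneg (abs_nonneg (t - s)))
  linarith

/-- Almost stable states are bounded. -/
theorem norm_le_of_stable (h : S.Regular κ L ρ c) {t : ℝ} (ht : t ∈ Icc 0 S.T) {z : Z} {e : ℝ}
    (he : 0 ≤ e) (hz : ∀ w, 0 ≤ S.dEnergy t z w + S.diss w + e * ‖w‖) :
    ‖z‖ ≤ (ρ * c + e + ‖S.dEnergy 0 0‖ + L * c * S.T) / κ := by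
  have h0 : (0 : ℝ) ∈ Icc 0 S.T := ⟨le_rfl, h.T_pos.le⟩
  rcases eq_or_ne z 0 with rfl | hz0
  · have := h.κ_pos
    have := h.c_pos
    have := h.ρ_nonneg
    have := h.L_nonneg
    have := h.T_pos
    rw [norm_zero]
    positivity
  · have hz' : 0 < ‖z‖ := norm_pos_iff.2 hz0
    have h1 := hz (-z)
    have h2 := h.diss_le_norm (-z)
    have h3 := h.monotone t z 0
    rw [sub_zero, h.dEnergy_apply 0 t 0] at h3
    rw [norm_neg] at h1 h2
    rw [map_neg] at h1
    have h4 := (abs_le.1 (h.load_le_norm h0 ht z)).2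
    have h5 := (abs_le.1 ((S.dEnergy 0 0).le_opNorm z)).1
    have h6 : L * c * |t - 0| * ‖z‖ ≤ L * c * S.T * ‖z‖ := by
      have := h.L_nonneg
      have := h.c_pos
      rw [sub_zero, abs_of_nonneg ht.1]
      gcongr
      exact ht.2
    rw [le_div_iff₀ h.κ_pos]
    refine le_of_mul_le_mul_right ?_ hz'
    nlinarith

end Regular

/-- An `ε`-approximate solution, described by its increments: these are dominated by those of
`G`, the states are stable up to `ε`, and the dissipation is balanced up to `ε`. -/
structure IsApproxSolution (S : RateIndependentSystem Z V X) (ε b : ℝ) (G : ℝ → ℝ) (y : ℝ → Z) :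
    Prop where
  initial : y 0 = S.z₀
  norm_le : ∀ t ∈ Icc 0 S.T, ‖y t‖ ≤ b
  continuousOn : ContinuousOn G (Icc 0 S.T)
  norm_sub_le : ∀ s ∈ Icc 0 S.T, ∀ t ∈ Icc 0 S.T, s ≤ t → ‖y t - y s‖ ≤ G t - G s
  stable : ∀ t ∈ Icc 0 S.T, ∀ w, 0 ≤ S.dEnergy t (y t) w + S.diss w + ε * ‖w‖
  dissipation : ∀ η > 0, ∃ δ > 0, ∀ s ∈ Icc 0 S.T, ∀ t ∈ Icc 0 S.T, s ≤ t → t - s ≤ δ →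
    S.diss (y t - y s) + S.dEnergy s (y s) (y t - y s) ≤ (ε + η) * (G t - G s)

/-- Approximate solutions stay close to each other, if one of them is Lipschitz continuous. -/
theorem Regular.exists_comparison (h : S.Regular κ L ρ c) {b K : ℝ} (hb : 0 ≤ b) (hK : 0 ≤ K) :
    ∃ C : ℝ, 0 ≤ C ∧ ∀ (ε₁ ε₂ : ℝ) (G : ℝ → ℝ) (y w : ℝ → Z), 0 ≤ ε₁ → 0 ≤ ε₂ →
      S.IsApproxSolution ε₁ b G y → S.IsApproxSolution ε₂ b (fun t => K * t) w →
      ∀ t ∈ Icc 0 S.T, ‖y t - w t‖ ^ 2 ≤ C * ((ε₁ + ε₂) * (G S.T - G 0 + K * S.T)) := by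
  obtain ⟨Λ, hΛ, lip⟩ := h.lipschitz b
  obtain ⟨M, hM, tay⟩ := h.taylor b
  have hκ := h.κ_pos
  set a := 2 * M * K / κ with ha
  have ha0 : 0 ≤ a := by positivity
  refine ⟨2 / κ * Real.exp (a * S.T), by positivity, ?_⟩
  intro ε₁ ε₂ G y w hε₁ hε₂ hy hw t ht
  have h0 : (0 : ℝ) ∈ Icc 0 S.T := ⟨le_rfl, h.T_pos.le⟩
  have hT : S.T ∈ Icc 0 S.T := ⟨h.T_pos.le, le_rfl⟩
  -- The Bregman distance of the energy. Time can be frozen at `0`, because a linear load cancels in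
  -- it.
  let D : ℝ → ℝ := fun t =>
    S.energy 0 (y t) - S.energy 0 (w t) - S.dEnergy 0 (w t) (y t - w t)
  have hD : ∀ t, κ / 2 * ‖y t - w t‖ ^ 2 ≤ D t := fun t => by
    have := h.tangent_le 0 (w t) (y t)
    simp only [D]; linarith
  let Γ : ℝ → ℝ := fun t => G t + K * t
  have hG : MonotoneOn G (Icc 0 S.T) := fun s hs t ht hst => by
    have := (norm_nonneg _).trans (hy.norm_sub_le s hs t ht hst); linarith
  have hΓ : MonotoneOn Γ (Icc 0 S.T) := fun s hs t ht hst => by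
    have := hG hs ht hst
    have := mul_le_mul_of_nonneg_left hst hK
    simp only [Γ]; linarith
  have hD0 : D 0 = 0 := by simp [D, hy.initial, hw.initial]
  have step : ∀ η > 0, ∃ δ > 0, ∀ s ∈ Icc 0 S.T, ∀ t ∈ Icc 0 S.T, s ≤ t → t - s ≤ δ →
      D t ≤ (1 + a * (t - s)) * D s + (ε₁ + ε₂ + η) * (Γ t - Γ s) := by
    intro η hη
    set Q := 2 * Λ + 2 * b * M + 1 with hQ
    have hQ0 : 0 < Q := by positivity
    set ω := η / (2 * Q) with hω
    have hω0 : 0 < ω := by positivity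
    obtain ⟨δ₁, hδ₁, d₁⟩ := hy.dissipation (η / 2) (by positivity)
    obtain ⟨δ₂, hδ₂, d₂⟩ := hw.dissipation (η / 2) (by positivity)
    have uc := isCompact_Icc.uniformContinuousOn_of_continuous hy.continuousOn
    obtain ⟨δ₃, hδ₃, d₃⟩ := Metric.uniformContinuousOn_iff.1 uc ω hω0
    refine ⟨min (min δ₁ δ₂) (min (δ₃ / 2) (ω / (K + 1))), by positivity, ?_⟩
    intro s hs t ht hst hd
    have hd1 : t - s ≤ δ₁ := hd.trans ((min_le_left _ _).trans (min_le_left _ _))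
    have hd2 : t - s ≤ δ₂ := hd.trans ((min_le_left _ _).trans (min_le_right _ _))
    have hd3 : t - s ≤ δ₃ / 2 := hd.trans ((min_le_right _ _).trans (min_le_left _ _))
    have hd4 : t - s ≤ ω / (K + 1) := hd.trans ((min_le_right _ _).trans (min_le_right _ _))
    have f1 := d₁ s hs t ht hst hd1
    have f2 := d₂ s hs t ht hst hd2
    have n1 := hy.norm_sub_le s hs t ht hst
    have n2 := hw.norm_sub_le s hs t ht hst
    have w1 : G t - G s ≤ ω := by
      have := d₃ t ht s hs (by rw [Real.dist_eq, abs_of_nonneg (by linarith)]; linarith)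
      rw [Real.dist_eq] at this
      exact (le_abs_self _).trans this.le
    have w2 : K * t - K * s ≤ ω := by
      rw [le_div_iff₀ (by positivity)] at hd4
      nlinarith
    have st1 := hw.stable s hs (y t - y s)
    have st2 := hy.stable s hs (w t - w s)
    have mem : ∀ {u : ℝ → Z} (_ : ∀ t ∈ Icc 0 S.T, ‖u t‖ ≤ b) (r) (_ : r ∈ Icc 0 S.T),
        u r ∈ Metric.closedBall (0 : Z) b := fun hu r hr => mem_closedBall_zero_iff.2 (hu r hr)
    have my0 := mem hy.norm_le s hs
    have my1 := mem hy.norm_le t ht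
    have mw0 := mem hw.norm_le s hs
    have mw1 := mem hw.norm_le t ht
    have l1 := (abs_le.1 (lip _ my1 _ my0 0 (y t - y s))).2
    have l2 := (abs_le.1 (lip _ mw1 _ mw0 0 (y t - y s))).1
    have l3 := (abs_le.1 (lip _ mw1 _ mw0 0 (w t - w s))).2
    have ty := (abs_le.1 (tay _ mw0 _ mw1 _ my0 0)).2
    have c1 := h.tangent_le 0 (y t) (y s)
    have c2 := h.tangent_le 0 (w s) (w t)
    have q1 := h.dEnergy_sub s 0 (y s) (w s) (y t - y s)
    have q2 := h.dEnergy_sub s 0 (y s) (w s) (w t - w s)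
    have hDs := hD s
    have nyw : ‖w s - y s‖ ≤ 2 * b := by
      have := norm_sub_le (w s) (y s)
      have := hy.norm_le s hs
      have := hw.norm_le s hs
      linarith
    have nsym := norm_sub_rev (w s) (y s)
    have p1 : 0 ≤ κ / 2 * ‖y s - y t‖ ^ 2 := by positivity
    have p2 : 0 ≤ κ / 2 * ‖w t - w s‖ ^ 2 := by positivity
    have e1 : S.dEnergy 0 (y t) (y s - y t) = -S.dEnergy 0 (y t) (y t - y s) := by
      rw [← map_neg, neg_sub]
    have e2 : S.dEnergy 0 (w t) (y t - w t) = S.dEnergy 0 (w t) (y t - y s)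
        - S.dEnergy 0 (w t) (w t - w s) - S.dEnergy 0 (w t) (w s - y s) := by
      rw [← map_sub, ← map_sub]; congr 1; abel
    have e3 : S.dEnergy 0 (w s) (y s - w s) = -S.dEnergy 0 (w s) (w s - y s) := by
      rw [← map_neg, neg_sub]
    set A := ‖y t - y s‖ with hA
    set B := ‖w t - w s‖ with hB
    set U := ‖w s - y s‖ with hU
    have hA0 : 0 ≤ A := norm_nonneg _
    have hB0 : 0 ≤ B := norm_nonneg _
    have hU0 : 0 ≤ U := norm_nonneg _
    set g := G t - G s with hg
    set k := K * t - K * s with hk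
    -- Convexity (`c1`, `c2`) replaces energy differences by derivatives. The force difference at
    -- time `s` tested with `y t - y s` is bounded by the dissipation of `y` minus the stability of
    -- `w`. The term `[D_z I(w t) - D_z I(w s)](w s - y s)` is turned by `ty` into a force
    -- difference tested with `w t - w s`, where the roles are exchanged.
    have main : D t ≤ D s + (ε₁ + η / 2) * g + ε₂ * A + (ε₂ + η / 2) * k + ε₁ * B
        + Λ * (A * A + B * A + B * B) + M * (B ^ 2 * U + U ^ 2 * B) := by
      simp only [D]
      rw [e2, e3]
      linarith
    -- The Gronwall term, and the only place where the linear bound on the increments of `w` is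
    -- essential: `U²` is controlled by `D s` and `B` by `K (t - s)`.
    have r1 : M * (U ^ 2 * B) ≤ a * (t - s) * D s := by
      have : U ^ 2 ≤ 2 / κ * D s := by
        rw [← nsym] at hDs
        rw [div_mul_eq_mul_div, le_div_iff₀ hκ]; linarith
      have hDs0 : 0 ≤ D s := hDs.trans' (by positivity)
      have hk' : k = K * (t - s) := by rw [hk]; ring
      calc M * (U ^ 2 * B) ≤ M * (2 / κ * D s * k) := by gcongr
        _ = _ := by rw [ha, hk']; ring
    have r2 : Λ * (A * A + B * A + B * B) + M * (B ^ 2 * U) ≤ η / 2 * (g + k) :=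
      quadratic_error_le hΛ hM hb hη hA0 hB0 n1 n2 w1 w2 nyw
    have r3 : ε₂ * A ≤ ε₂ * g := by gcongr
    have r4 : ε₁ * B ≤ ε₁ * k := by gcongr
    have e5 : Γ t - Γ s = g + k := by simp only [Γ, hg, hk]; ring
    rw [e5]
    linarith
  have fin := le_exp_mul_of_small_increments ha0 (add_nonneg hε₁ hε₂) hD0.ge hΓ step ht
  rw [hD0, zero_add] at fin
  have hΓT : Γ t - Γ 0 ≤ G S.T - G 0 + K * S.T := by
    have := hΓ ht hT ht.2
    simp only [Γ] at this ⊢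
    linarith
  have hΓ0 : 0 ≤ Γ t - Γ 0 := sub_nonneg.2 (hΓ h0 ht ht.1)
  have fin' : D t ≤ Real.exp (a * S.T) * ((ε₁ + ε₂) * (G S.T - G 0 + K * S.T)) := by
    refine fin.trans ?_
    gcongr
    exact ht.2
  have := hD t
  rw [mul_assoc, div_mul_eq_mul_div, le_div_iff₀ hκ]
  linarith

end RateIndependentSystem

/-! ### Lipschitz curves in Hilbert spaces are primitives. -/

section HilbertValued

open Filter Topology

variable {E : Type*} [NormedAddCommGroup E]

theorem lipschitzOnWith_Icc_of_norm_sub_le {f : ℝ → E} {a b : ℝ} {K : ℝ≥0}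
    (h : ∀ s ∈ Icc a b, ∀ t ∈ Icc a b, s ≤ t → ‖f t - f s‖ ≤ K * (t - s)) :
    LipschitzOnWith K f (Icc a b) := by
  refine LipschitzOnWith.of_dist_le_mul fun s hs t ht => ?_
  rw [dist_eq_norm, Real.dist_eq]
  rcases le_total s t with hst | hst
  · rw [norm_sub_rev, abs_sub_comm, abs_of_nonneg (sub_nonneg.2 hst)]
    exact h s hs t ht hst
  · rw [abs_of_nonneg (sub_nonneg.2 hst)]
    exact h t ht s hs hst

/-- A bounded sequence in a Hilbert space converges weakly along the hyperfilter. -/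
theorem exists_weak_limit [InnerProductSpace ℝ E] [CompleteSpace E] {u : ℕ → E} {B : ℝ}
    (hu : ∀ n, ‖u n‖ ≤ B) :
    ∃ x : E, ∀ φ : E, Tendsto (fun n => inner ℝ (u n) φ) (hyperfilter ℕ) (𝓝 (inner ℝ x φ)) := by
  let d : ℕ → WeakDual ℝ E := fun n => StrongDual.toWeakDual (InnerProductSpace.toDual ℝ E (u n))
  have hK := WeakDual.isCompact_closedBall (𝕜 := ℝ) (E := E) 0 B
  -- Banach–Alaoglu along an ultrafilter: no subsequence is extracted, so no separability is needed.
  obtain ⟨x, -, hx⟩ := hK.ultrafilter_le_nhds ((hyperfilter ℕ).map d) (by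
    rw [le_principal_iff]
    refine Filter.mem_map.2 (Filter.univ_mem' fun n => ?_)
    simpa [d] using hu n)
  refine ⟨(InnerProductSpace.toDual ℝ E).symm (WeakDual.toStrongDual x), fun φ => ?_⟩
  have h1 : Tendsto d (hyperfilter ℕ) (𝓝 x) := hx
  have h2 := ((WeakDual.eval_continuous φ).tendsto x).comp h1
  simpa [d, Function.comp_def] using h2

theorem tendsto_average_of_continuous [NormedSpace ℝ E] [CompleteSpace E] {f : ℝ → E}
    (hf : Continuous f) (t : ℝ) :
    Tendsto (fun n : ℕ => ((n : ℝ) + 1) • ∫ u in t..(t + 1 / ((n : ℝ) + 1)), f u) atTop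
      (𝓝 (f t)) := by
  have hd : HasDerivAt (fun x => ∫ u in t..x, f u) (f t) t :=
    intervalIntegral.integral_hasDerivAt_right (hf.intervalIntegrable _ _)
      (hf.stronglyMeasurableAtFilter _ _) hf.continuousAt
  have h1 := hasDerivAt_iff_tendsto_slope_zero.1 hd
  have h2 : Tendsto (fun n : ℕ => 1 / ((n : ℝ) + 1)) atTop (𝓝[≠] 0) := by
    refine tendsto_nhdsWithin_iff.2 ⟨tendsto_one_div_add_atTop_nhds_zero_nat, ?_⟩
    exact Eventually.of_forall fun n => by
      have : (0 : ℝ) < 1 / ((n : ℝ) + 1) := by positivity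
      exact this.ne'
  refine (h1.comp h2).congr fun n => ?_
  simp

/-- A Lipschitz curve in a Hilbert space is the primitive of an integrable function. -/
theorem LipschitzWith.exists_eq_add_integral [InnerProductSpace ℝ E] [CompleteSpace E] {f : ℝ → E}
    {K : ℝ≥0} (hf : LipschitzWith K f) (T : ℝ) (hT : 0 ≤ T) :
    ∃ g : ℝ → E, IntervalIntegrable g volume 0 T ∧
      ∀ t ∈ Icc 0 T, f t = f 0 + ∫ s in (0 : ℝ)..t, g s := by
  have fc := hf.continuous
  set μ : Measure ℝ := volume.restrict (Ioc 0 T) with hμ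
  -- The difference quotients are bounded by `K`, hence bounded in `L²`, and the density is a weak
  -- limit `g`. Testing with `v` times the indicator of `(0,t]` identifies it: the integral of `q n`
  -- is a difference of short averages of `f` at `t` and at `0`, which tends to `f t - f 0`.
  let q : ℕ → ℝ → E := fun n u => ((n : ℝ) + 1) • (f (u + 1 / ((n : ℝ) + 1)) - f u)
  have qc : ∀ n, Continuous (q n) := fun n => by fun_prop
  have qb : ∀ n u, ‖q n u‖ ≤ K := fun n u => by
    have hn : (0 : ℝ) < (n : ℝ) + 1 := by positivity
    have h := hf.dist_le_mul (u + 1 / ((n : ℝ) + 1)) u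
    rw [dist_eq_norm, Real.dist_eq, add_sub_cancel_left, abs_of_pos (by positivity)] at h
    rw [norm_smul, Real.norm_of_nonneg hn.le]
    calc ((n : ℝ) + 1) * _ ≤ ((n : ℝ) + 1) * (K * (1 / ((n : ℝ) + 1))) := by gcongr
      _ = K := by field_simp
  have qm : ∀ n, MemLp (q n) 2 μ := fun n =>
    MemLp.of_bound (qc n).aestronglyMeasurable K (Eventually.of_forall (qb n))
  let Q : ℕ → Lp E 2 μ := fun n => (qm n).toLp (q n)
  obtain ⟨g, hg⟩ := exists_weak_limit (u := Q) (fun n =>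
    Lp.norm_le_of_ae_bound K.2 (by
      filter_upwards [(qm n).coeFn_toLp] with u hu
      rw [hu]; exact qb n u))
  have gi : IntervalIntegrable g volume 0 T := by
    rw [intervalIntegrable_iff_integrableOn_Ioc_of_le hT]
    exact (Lp.memLp g).integrable (by norm_num)
  refine ⟨g, gi, fun t ht => ?_⟩
  have hsub : Ioc 0 t ⊆ Ioc 0 T := Ioc_subset_Ioc_right ht.2
  have restr : μ.restrict (Ioc 0 t) = volume.restrict (Ioc 0 t) := by
    rw [hμ, Measure.restrict_restrict measurableSet_Ioc, inter_eq_self_of_subset_left hsub]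
  have inn : ∀ (φ : Lp E 2 μ) (v : E),
      inner ℝ φ (indicatorConstLp 2 (measurableSet_Ioc (a := (0 : ℝ)) (b := t))
        (measure_ne_top μ _) v) = inner ℝ v (∫ s in (0 : ℝ)..t, φ s) := fun φ v => by
    rw [real_inner_comm, L2.inner_indicatorConstLp_eq_inner_setIntegral, restr,
      intervalIntegral.integral_of_le ht.1]
  have qint : ∀ n, ∫ s in (0 : ℝ)..t, Q n s = ∫ s in (0 : ℝ)..t, q n s := fun n => by
    rw [intervalIntegral.integral_of_le ht.1, intervalIntegral.integral_of_le ht.1, ← restr]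
    exact integral_congr_ae (ae_restrict_of_ae (qm n).coeFn_toLp)
  have qval : ∀ n, ∫ s in (0 : ℝ)..t, q n s =
      ((n : ℝ) + 1) • (∫ u in t..(t + 1 / ((n : ℝ) + 1)), f u) -
      ((n : ℝ) + 1) • (∫ u in (0 : ℝ)..(0 + 1 / ((n : ℝ) + 1)), f u) := fun n => by
    have ii : ∀ a b : ℝ, IntervalIntegrable f volume a b := fun a b => fc.intervalIntegrable a b
    have ic : IntervalIntegrable (fun u => f (u + 1 / ((n : ℝ) + 1))) volume 0 t :=
      Continuous.intervalIntegrable (by fun_prop) _ _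
    simp only [q]
    rw [intervalIntegral.integral_smul, intervalIntegral.integral_sub ic (ii _ _),
      intervalIntegral.integral_comp_add_right, ← smul_sub]
    congr 1
    rw [intervalIntegral.integral_interval_sub_interval_comm (ii _ _) (ii _ _) (ii _ _),
      intervalIntegral.integral_symm t, intervalIntegral.integral_symm _ (0 : ℝ)]
    abel
  have lim : Tendsto (fun n => ∫ s in (0 : ℝ)..t, q n s) atTop (𝓝 (f t - f 0)) := by
    simp only [qval]
    exact (tendsto_average_of_continuous fc t).sub (tendsto_average_of_continuous fc 0)
  have key : f t - f 0 = ∫ s in (0 : ℝ)..t, g s := by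
    refine ext_inner_left ℝ fun v => ?_
    have h1 := hg (indicatorConstLp 2 (measurableSet_Ioc (a := (0 : ℝ)) (b := t))
        (measure_ne_top μ _) v)
    simp only [inn, qint] at h1
    have h2 : Tendsto (fun n => inner ℝ v (∫ s in (0 : ℝ)..t, q n s)) (hyperfilter ℕ)
        (𝓝 (inner ℝ v (f t - f 0))) :=
      (tendsto_const_nhds.inner lim).mono_left
        (hyperfilter_le_cofinite.trans Nat.cofinite_eq_atTop.le)
    exact tendsto_nhds_unique h2 h1
  rw [← key]; abel

end HilbertValued

/-! ### Differential solutions and the incremental conditions without error. -/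

namespace RateIndependentSystem

variable {Z V X : Type*}
  [NormedAddCommGroup Z] [InnerProductSpace ℝ Z]
  [NormedAddCommGroup V] [InnerProductSpace ℝ V]
  [NormedAddCommGroup X] [NormedSpace ℝ X]
  {S : RateIndependentSystem Z V X} {κ L ρ c : ℝ}

namespace Regular

theorem continuous_diss (h : S.Regular κ L ρ c) : Continuous S.diss := by
  have hρ : 0 ≤ ρ * c := mul_nonneg h.ρ_nonneg h.c_pos.le
  refine (LipschitzWith.of_le_add_mul ⟨ρ * c, hρ⟩ fun v w => ?_).continuous
  have h1 := h.diss_add_le w (v - w)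
  have h2 := h.diss_le_norm (v - w)
  rw [add_sub_cancel] at h1
  rw [dist_eq_norm]
  exact h1.trans (by gcongr; exact h2)

theorem convexOn_diss (h : S.Regular κ L ρ c) : ConvexOn ℝ univ S.diss := by
  refine ⟨convex_univ, fun v _ w _ a b ha hb _ => ?_⟩
  rw [smul_eq_mul, smul_eq_mul, ← h.diss_smul a ha, ← h.diss_smul b hb]
  exact h.diss_add_le _ _

theorem dEnergy_eq (h : S.Regular κ L ρ c) (t : ℝ) (z : Z) :
    S.dEnergy t z = S.dEnergy 0 z - (S.ℓ t - S.ℓ 0).comp S.ι := by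
  ext w
  exact h.dEnergy_apply 0 t z w

theorem continuous_dEnergy_at (h : S.Regular κ L ρ c) (t : ℝ) : Continuous (S.dEnergy t) := by
  rw [funext (h.dEnergy_eq t)]
  exact h.continuous_dEnergy.sub continuous_const

theorem continuousOn_dEnergy (h : S.Regular κ L ρ c) {y : ℝ → Z}
    (hy : ContinuousOn y (Icc 0 S.T)) :
    ContinuousOn (fun t => S.dEnergy t (y t)) (Icc 0 S.T) := by
  have e : (fun t => S.dEnergy t (y t)) =
      fun t => S.dEnergy 0 (y t) - (S.ℓ t - S.ℓ 0).comp S.ι := funext fun t => h.dEnergy_eq t _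
  rw [e]
  refine (h.continuous_dEnergy.comp_continuousOn hy).sub ?_
  exact (h.continuousOn_load.sub continuousOn_const).clm_comp continuousOn_const

/-- A Lipschitz curve that satisfies the incremental conditions without error is a differential
solution. -/
theorem isDifferentialSolution [CompleteSpace Z] (h : S.Regular κ L ρ c) (hS : S.Assumptions)
    {b K : ℝ} {y : ℝ → Z} (hy : S.IsApproxSolution 0 b (fun t => K * t) y) :
    S.IsDifferentialSolution y := by
  have hT := h.T_pos
  have h0 : (0 : ℝ) ∈ Icc 0 S.T := ⟨le_rfl, hT.le⟩
  have hTm : S.T ∈ Icc 0 S.T := ⟨hT.le, le_rfl⟩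
  have hK : 0 ≤ K := by
    have := (norm_nonneg _).trans (hy.norm_sub_le 0 h0 S.T hTm hT.le)
    rw [mul_zero, sub_zero] at this
    exact nonneg_of_mul_nonneg_left this hT
  let K' : ℝ≥0 := ⟨K, hK⟩
  have lip : LipschitzOnWith K' y (Icc 0 S.T) := by
    refine lipschitzOnWith_Icc_of_norm_sub_le fun s hs t ht hst => ?_
    exact (hy.norm_sub_le s hs t ht hst).trans_eq (mul_sub K t s).symm
  -- The constant extension outside `[0,T]` makes the curve globally Lipschitz.
  have lipE : LipschitzWith K' (IccExtend hT.le ((Icc 0 S.T).domRestrict y)) := by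
    have := lip.to_restrict.comp (LipschitzWith.projIcc hT.le)
    rw [mul_one] at this
    exact this
  obtain ⟨g, gi, hg⟩ := lipE.exists_eq_add_integral S.T hT.le
  have ext : ∀ t ∈ Icc 0 S.T, IccExtend hT.le ((Icc 0 S.T).domRestrict y) t = y t := fun t ht => by
    rw [IccExtend_of_mem hT.le _ ht]; rfl
  have hg' : ∀ t ∈ Icc 0 S.T, y t = y 0 + ∫ s in (0 : ℝ)..t, g s := fun t ht => by
    rw [← ext t ht, ← ext 0 h0]; exact hg t ht
  refine ⟨hy.initial, g, gi, hg', ?_⟩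
  have diff := gi.ae_hasDerivAt_integral
  rw [ae_restrict_congr_set Ioo_ae_eq_Icc.symm, ae_restrict_iff' measurableSet_Ioo]
  filter_upwards [diff] with t ht htI
  have htI' := Ioo_subset_Icc_self htI
  rw [hS.inclusion_iff]
  refine ⟨fun w => by simpa using hy.stable t htI' w, ?_⟩
  have hd := ht (by rw [uIcc_of_le hT.le]; exact htI') 0 (by rw [uIcc_of_le hT.le]; exact h0)
  -- Only increments forward in time are used: the dissipation inequality is divided by `x > 0`,
  -- where `R` is homogeneous, and `x` tends to `0`.
  have hsl := (hasDerivAt_iff_tendsto_slope_zero.1 hd).mono_left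
    (nhdsWithin_mono (0 : ℝ) (fun x (hx : 0 < x) => hx.ne') :
      nhdsWithin (0 : ℝ) (Ioi 0) ≤ nhdsWithin 0 {0}ᶜ)
  have hcont : Continuous fun v => S.dEnergy t (y t) v + S.diss v :=
    (S.dEnergy t (y t)).continuous.add h.continuous_diss
  have hlim := (hcont.tendsto (g t)).comp hsl
  have bound : ∀ η > 0, S.dEnergy t (y t) (g t) + S.diss (g t) ≤ η * K := by
    intro η hη
    obtain ⟨δ, hδ, hdis⟩ := hy.dissipation η hη
    refine le_of_tendsto hlim ?_
    have hev : Ioo (0 : ℝ) (min δ (S.T - t)) ∈ nhdsWithin (0 : ℝ) (Ioi 0) :=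
      Ioo_mem_nhdsGT (lt_min hδ (sub_pos.2 htI.2))
    filter_upwards [hev] with x hx
    have hx0 := hx.1
    have hx1 := hx.2.trans_le (min_le_left _ _)
    have hx2 := hx.2.trans_le (min_le_right _ _)
    have hm : t + x ∈ Icc 0 S.T := ⟨by linarith [htI.1], by linarith⟩
    have hinc : (∫ s in (0 : ℝ)..(t + x), g s) - ∫ s in (0 : ℝ)..t, g s = y (t + x) - y t := by
      rw [hg' _ hm, hg' t htI']; abel
    have := hdis t htI' (t + x) hm (by linarith) (by linarith)
    simp only [Function.comp, hinc]
    rw [map_smul, h.diss_smul _ (inv_nonneg.2 hx0.le), smul_eq_mul, ← mul_add,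
      inv_mul_le_iff₀ hx0]
    linarith
  rw [← sub_nonpos, sub_zero]
  refine le_of_forall_pos_le_add fun e he => ?_
  have := bound (e / (K + 1)) (by positivity)
  have : e / (K + 1) * K ≤ e := by
    rw [div_mul_eq_mul_div, div_le_iff₀ (by positivity)]
    nlinarith
  linarith

end Regular

end RateIndependentSystem

/-- A continuous function that is nonnegative almost everywhere on an interval is nonnegative
there. -/
theorem nonneg_of_ae_nonneg_of_continuousOn {φ : ℝ → ℝ} {a b : ℝ} (hab : a < b)
    (hφ : ContinuousOn φ (Icc a b)) (h : ∀ᵐ t ∂(volume.restrict (Icc a b)), 0 ≤ φ t) :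
    ∀ t ∈ Icc a b, 0 ≤ φ t := by
  rw [ae_restrict_iff' measurableSet_Icc] at h
  have hd : Dense {t | t ∈ Icc a b → 0 ≤ φ t} := Measure.dense_of_ae h
  have hc : IsClosed (Icc a b ∩ φ ⁻¹' Ici 0) := hφ.preimage_isClosed_of_isClosed isClosed_Icc
    isClosed_Ici
  have h1 := hd.open_subset_closure_inter (isOpen_Ioo (a := a) (b := b))
  have h2 : Ioo a b ∩ {t | t ∈ Icc a b → 0 ≤ φ t} ⊆ Icc a b ∩ φ ⁻¹' Ici 0 := fun t ht =>
    ⟨Ioo_subset_Icc_self ht.1, ht.2 (Ioo_subset_Icc_self ht.1)⟩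
  have h3 : Icc a b ⊆ Icc a b ∩ φ ⁻¹' Ici 0 := by
    rw [← closure_Ioo hab.ne]
    refine closure_minimal (h1.trans ?_) (by rw [closure_Ioo hab.ne]; exact hc)
    rw [closure_Ioo hab.ne]
    exact closure_minimal h2 hc
  exact fun t ht => (h3 ht).2

theorem tendsto_apply {E : Type*} [NormedAddCommGroup E] [NormedSpace ℝ E] {α : Type*}
    {l : Filter α} {f : α → StrongDual ℝ E} {u : α → E} {f₀ : StrongDual ℝ E} {u₀ : E}
    (hf : Filter.Tendsto f l (nhds f₀)) (hu : Filter.Tendsto u l (nhds u₀)) :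
    Filter.Tendsto (fun n => f n (u n)) l (nhds (f₀ u₀)) := by
  have hc : Continuous fun p : StrongDual ℝ E × E => p.1 p.2 := continuous_fst.clm_apply
    continuous_snd
  exact (hc.tendsto (f₀, u₀)).comp (hf.prodMk_nhds hu)

namespace RateIndependentSystem

variable {Z V X : Type*}
  [NormedAddCommGroup Z] [InnerProductSpace ℝ Z]
  [NormedAddCommGroup V] [InnerProductSpace ℝ V]
  [NormedAddCommGroup X] [NormedSpace ℝ X]
  {S : RateIndependentSystem Z V X} {κ L ρ c : ℝ}

/-- Jensen's inequality for the average over `(s,t]`; homogeneity removes the factor `1 / (t - s)`.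
-/
theorem Regular.diss_integral_le [CompleteSpace Z] (h : S.Regular κ L ρ c) {g : ℝ → Z} {s t : ℝ}
    (hst : s ≤ t) (hg : IntervalIntegrable g volume s t) :
    IntervalIntegrable (fun u => S.diss (g u)) volume s t ∧
      S.diss (∫ u in s..t, g u) ≤ ∫ u in s..t, S.diss (g u) := by
  have hgi := (intervalIntegrable_iff_integrableOn_Ioc_of_le hst).1 hg
  have hdi : IntegrableOn (fun u => S.diss (g u)) (Ioc s t) volume := by
    refine (hgi.norm.const_mul (ρ * c)).mono'
      (h.continuous_diss.comp_aestronglyMeasurable hgi.aestronglyMeasurable) ?_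
    refine Filter.Eventually.of_forall fun u => ?_
    rw [Real.norm_of_nonneg (h.diss_nonneg _)]
    exact h.diss_le_norm _
  refine ⟨(intervalIntegrable_iff_integrableOn_Ioc_of_le hst).2 hdi, ?_⟩
  rcases hst.eq_or_lt with rfl | hst'
  · simp [h.diss_zero]
  have hpos : 0 < t - s := sub_pos.2 hst'
  have hj := h.convexOn_diss.map_set_average_le h.continuous_diss.continuousOn isClosed_univ
    (μ := volume) (t := Ioc s t) (f := g) (by simp [hst']) (by simp) (by simp) hgi hdi
  have hr : volume.real (Ioc s t) = t - s := by simp [Real.volume_real_Ioc_of_le hst]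
  rw [setAverage_eq, setAverage_eq, hr, h.diss_smul _ (inv_nonneg.2 hpos.le), smul_eq_mul] at hj
  rw [intervalIntegral.integral_of_le hst, intervalIntegral.integral_of_le hst]
  exact le_of_mul_le_mul_left hj (inv_pos.2 hpos)

/-- Differential solutions satisfy the incremental conditions without error. -/
theorem IsDifferentialSolution.exists_isApproxSolution [CompleteSpace Z]
    (h : S.Regular κ L ρ c) (hS : S.Assumptions) {y : ℝ → Z} (hy : S.IsDifferentialSolution y)
    {b : ℝ} (hb : (ρ * c + ‖S.dEnergy 0 0‖ + L * c * S.T) / κ ≤ b) :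
    ∃ G : ℝ → ℝ, S.IsApproxSolution 0 b G y := by
  obtain ⟨hy0, g, gi, hg, hinc⟩ := hy
  have hT := h.T_pos
  have h0 : (0 : ℝ) ∈ Icc 0 S.T := ⟨le_rfl, hT.le⟩
  have gs : ∀ s ∈ Icc 0 S.T, ∀ t ∈ Icc 0 S.T, IntervalIntegrable g volume s t := fun s hs t ht =>
    gi.mono_set (uIcc_subset_uIcc (by rwa [uIcc_of_le hT.le]) (by rwa [uIcc_of_le hT.le]))
  have yc : ContinuousOn y (Icc 0 S.T) := by
    refine ContinuousOn.congr (f := fun t => y 0 + ∫ s in (0 : ℝ)..t, g s) ?_ hg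
    refine continuousOn_const.add ?_
    rw [← uIcc_of_le hT.le]
    exact intervalIntegral.continuousOn_primitive_interval' gi left_mem_uIcc
  have dc := h.continuousOn_dEnergy yc
  have hinc' : ∀ᵐ t ∂(volume.restrict (Icc 0 S.T)),
      (∀ w, 0 ≤ S.dEnergy t (y t) w + S.diss w) ∧ S.dEnergy t (y t) (g t) + S.diss (g t) ≤ 0 := by
    filter_upwards [hinc] with t ht
    exact (hS.inclusion_iff _ _ _).1 ht
  have stable : ∀ t ∈ Icc 0 S.T, ∀ w, 0 ≤ S.dEnergy t (y t) w + S.diss w := fun t ht w => by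
    refine nonneg_of_ae_nonneg_of_continuousOn hT (φ := fun t => S.dEnergy t (y t) w + S.diss w)
      ((dc.clm_apply continuousOn_const).add continuousOn_const) ?_ t ht
    filter_upwards [hinc'] with t ht
    exact ht.1 w
  have incr : ∀ s ∈ Icc 0 S.T, ∀ t ∈ Icc 0 S.T, y t - y s = ∫ u in s..t, g u :=
    fun s hs t ht => by
      rw [hg t ht, hg s hs, add_sub_add_left_eq_sub,
        intervalIntegral.integral_interval_sub_left (gs 0 h0 t ht) (gs 0 h0 s hs)]
  have gincr : ∀ s ∈ Icc 0 S.T, ∀ t ∈ Icc 0 S.T,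
      (∫ u in (0 : ℝ)..t, ‖g u‖) - ∫ u in (0 : ℝ)..s, ‖g u‖ = ∫ u in s..t, ‖g u‖ :=
    fun s hs t ht =>
      intervalIntegral.integral_interval_sub_left (gs 0 h0 t ht).norm (gs 0 h0 s hs).norm
  refine ⟨fun t => ∫ u in (0 : ℝ)..t, ‖g u‖, hy0, fun t ht => ?_, ?_, ?_, ?_, ?_⟩
  · refine (h.norm_le_of_stable ht le_rfl (e := 0) fun w => ?_).trans (by simpa using hb)
    simpa using stable t ht w
  · rw [← uIcc_of_le hT.le]
    exact intervalIntegral.continuousOn_primitive_interval' gi.norm left_mem_uIcc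
  · intro s hs t ht hst
    rw [incr s hs t ht, gincr s hs t ht]
    exact intervalIntegral.norm_integral_le_integral_norm hst
  · intro t ht w
    simpa using stable t ht w
  · intro η hη
    have uc := isCompact_Icc.uniformContinuousOn_of_continuous dc
    obtain ⟨δ, hδ, hd⟩ := Metric.uniformContinuousOn_iff.1 uc η hη
    refine ⟨δ / 2, by positivity, fun s hs t ht hst hts => ?_⟩
    have hi := gs s hs t ht
    obtain ⟨hri, hr⟩ := h.diss_integral_le hst hi
    have hΨ : IntervalIntegrable (fun u => S.dEnergy s (y s) (g u)) volume s t :=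
      ⟨(S.dEnergy s (y s)).integrable_comp hi.1, (S.dEnergy s (y s)).integrable_comp hi.2⟩
    rw [gincr s hs t ht, incr s hs t ht, zero_add,
      ← (S.dEnergy s (y s)).intervalIntegral_comp_comm hi, ← intervalIntegral.integral_const_mul]
    refine (add_le_add_left hr _).trans ?_
    rw [← intervalIntegral.integral_add hri hΨ]
    refine intervalIntegral.integral_mono_ae_restrict hst (hri.add hΨ) (hi.norm.const_mul η) ?_
    have hsub : Icc s t ⊆ Icc 0 S.T := Icc_subset_Icc hs.1 ht.2
    have h1 := ae_restrict_of_ae_restrict_of_subset hsub hinc'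
    filter_upwards [h1, ae_restrict_mem measurableSet_Icc] with u hu hum
    -- Freezing the force at time `s` costs `η ‖g u‖`, by uniform continuity of `t ↦ D_z I(t, y t)`.
    have h2 := hd u (hsub hum) s hs (by
      rw [Real.dist_eq, abs_of_nonneg (sub_nonneg.2 hum.1)]; linarith [hum.2])
    rw [dist_eq_norm] at h2
    have h3 := (abs_le.1 ((S.dEnergy u (y u) - S.dEnergy s (y s)).le_opNorm (g u))).1
    rw [sub_apply] at h3
    have h4 : ‖S.dEnergy u (y u) - S.dEnergy s (y s)‖ * ‖g u‖ ≤ η * ‖g u‖ := by gcongr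
    have h5 := hu.2
    linarith

/-! ### Lipschitz approximate solutions and their limits. -/

/-- A Lipschitz continuous approximate solution with a quantitative dissipation balance. -/
structure IsLipschitzApprox (S : RateIndependentSystem Z V X) (ε b K Q : ℝ) (y : ℝ → Z) :
    Prop where
  initial : y 0 = S.z₀
  norm_le : ∀ t ∈ Icc 0 S.T, ‖y t‖ ≤ b
  norm_sub_le : ∀ s ∈ Icc 0 S.T, ∀ t ∈ Icc 0 S.T, s ≤ t → ‖y t - y s‖ ≤ K * (t - s)
  stable : ∀ t ∈ Icc 0 S.T, ∀ w, 0 ≤ S.dEnergy t (y t) w + S.diss w + ε * ‖w‖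
  dissipation : ∀ s ∈ Icc 0 S.T, ∀ t ∈ Icc 0 S.T, s ≤ t →
    S.diss (y t - y s) + S.dEnergy s (y s) (y t - y s) ≤ (ε + Q * (t - s)) * (K * (t - s))

theorem IsLipschitzApprox.isApproxSolution {ε b K Q : ℝ} {y : ℝ → Z} (hK : 0 ≤ K) (hQ : 0 ≤ Q)
    (hy : S.IsLipschitzApprox ε b K Q y) : S.IsApproxSolution ε b (fun t => K * t) y := by
  refine ⟨hy.initial, hy.norm_le, by fun_prop, fun s hs t ht hst => ?_, hy.stable,
    fun η hη => ⟨η / (Q + 1), by positivity, fun s hs t ht hst hd => ?_⟩⟩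
  · rw [← mul_sub]; exact hy.norm_sub_le s hs t ht hst
  · refine (hy.dissipation s hs t ht hst).trans ?_
    rw [← mul_sub]
    have h1 : 0 ≤ t - s := sub_nonneg.2 hst
    have h2 : Q * (t - s) ≤ η := by
      rw [le_div_iff₀ (by positivity)] at hd
      nlinarith
    gcongr

/-- If there are Lipschitz continuous approximate solutions with arbitrarily small error, then
there is a Lipschitz continuous curve that satisfies the incremental conditions without error. -/
theorem Regular.exists_limit [CompleteSpace Z] (h : S.Regular κ L ρ c) {b K Q : ℝ} (hb : 0 ≤ b)
    (hK : 0 ≤ K) (hQ : 0 ≤ Q) {ε : ℕ → ℝ} {y : ℕ → ℝ → Z} (hε : ∀ n, 0 ≤ ε n)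
    (hlim : Filter.Tendsto ε Filter.atTop (nhds 0))
    (hy : ∀ n, S.IsLipschitzApprox (ε n) b K Q (y n)) :
    ∃ z : ℝ → Z, S.IsLipschitzApprox 0 b K Q z := by
  have h0 : (0 : ℝ) ∈ Icc 0 S.T := ⟨le_rfl, h.T_pos.le⟩
  obtain ⟨C, hC, comp⟩ := h.exists_comparison hb hK
  have cau : ∀ t ∈ Icc 0 S.T, ∃ z, Filter.Tendsto (fun n => y n t) Filter.atTop (nhds z) := by
    intro t ht
    refine cauchySeq_tendsto_of_complete (Metric.cauchySeq_iff'.2 fun e he => ?_)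
    set D := C * (K * S.T + K * S.T) with hD
    have hT := h.T_pos
    have hD0 : 0 ≤ D := by positivity
    have hsmall : ∀ᶠ n in Filter.atTop, ε n < e ^ 2 / (2 * (D + 1)) :=
      hlim.eventually_lt_const (by positivity)
    obtain ⟨N, hN⟩ := Filter.eventually_atTop.1 hsmall
    refine ⟨N, fun n hn => ?_⟩
    have h1 := comp (ε n) (ε N) _ _ _ (hε n) (hε N) ((hy n).isApproxSolution hK hQ)
      ((hy N).isApproxSolution hK hQ) t ht
    have h2 := hN n hn
    have h3 := hN N le_rfl
    rw [dist_eq_norm]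
    refine lt_of_pow_lt_pow_left₀ 2 he.le (h1.trans_lt ?_)
    have h4 : ε n + ε N ≤ e ^ 2 / (D + 1) := by
      have : e ^ 2 / (D + 1) = e ^ 2 / (2 * (D + 1)) + e ^ 2 / (2 * (D + 1)) := by
        field_simp; ring
      linarith
    rw [mul_zero, sub_zero]
    calc C * ((ε n + ε N) * (K * S.T + K * S.T)) = (ε n + ε N) * D := by rw [hD]; ring
      _ ≤ e ^ 2 / (D + 1) * D := by gcongr
      _ < e ^ 2 := by
        rw [div_mul_eq_mul_div, div_lt_iff₀ (by positivity)]
        nlinarith [pow_pos he 2]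
  choose! z hz using cau
  refine ⟨z, ?_, fun t ht => ?_, fun s hs t ht hst => ?_, fun t ht w => ?_, fun s hs t ht hst => ?_⟩
  · refine tendsto_nhds_unique (hz 0 h0) ?_
    simp only [(hy _).initial]
    exact tendsto_const_nhds
  · exact le_of_tendsto (hz t ht).norm (Filter.Eventually.of_forall fun n => (hy n).norm_le t ht)
  · exact le_of_tendsto ((hz t ht).sub (hz s hs)).norm
      (Filter.Eventually.of_forall fun n => (hy n).norm_sub_le s hs t ht hst)
  · have hc : Filter.Tendsto (fun n => S.dEnergy t (y n t)) Filter.atTop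
        (nhds (S.dEnergy t (z t))) := ((h.continuous_dEnergy_at t).tendsto _).comp (hz t ht)
    have hd := tendsto_apply hc (tendsto_const_nhds (x := w))
    exact ge_of_tendsto ((hd.add_const (S.diss w)).add (hlim.mul_const ‖w‖))
      (Filter.Eventually.of_forall fun n => (hy n).stable t ht w)
  · have hΔ := (hz t ht).sub (hz s hs)
    have hc : Filter.Tendsto (fun n => S.dEnergy s (y n s)) Filter.atTop
        (nhds (S.dEnergy s (z s))) := ((h.continuous_dEnergy_at s).tendsto _).comp (hz s hs)
    have hd := tendsto_apply hc hΔ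
    -- The modulus `Q (t - s)` is common to all `n`, so the inequality passes to the limit at fixed
    -- `s` and `t`; a `δ` depending on `n` would be lost.
    exact le_of_tendsto_of_tendsto' (((h.continuous_diss.tendsto _).comp hΔ).add hd)
      ((hlim.add_const (Q * (t - s))).mul_const (K * (t - s)))
      fun n => (hy n).dissipation s hs t ht hst

end RateIndependentSystem

/-! ### Existence of minimizers and of iterates. -/

/-- A continuous function that is bounded below and strongly midpoint convex attains its minimum
on every nonempty, closed, midpoint convex set. -/
theorem exists_forall_le_of_midpoint {E : Type*} [NormedAddCommGroup E] [NormedSpace ℝ E]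
    [CompleteSpace E] {f : E → ℝ} {κ B : ℝ} (hκ : 0 < κ) (hf : Continuous f) (hB : ∀ x, B ≤ f x)
    (hmid : ∀ x y, f ((1 / 2 : ℝ) • (x + y)) + κ * ‖x - y‖ ^ 2 ≤ (f x + f y) / 2)
    {s : Set E} (hs : IsClosed s) (hne : s.Nonempty)
    (hconv : ∀ x ∈ s, ∀ y ∈ s, (1 / 2 : ℝ) • (x + y) ∈ s) : ∃ x ∈ s, ∀ y ∈ s, f x ≤ f y := by
  set m := sInf (f '' s) with hm
  have hbdd : BddBelow (f '' s) := ⟨B, by rintro _ ⟨x, -, rfl⟩; exact hB x⟩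
  have hle : ∀ x ∈ s, m ≤ f x := fun x hx => csInf_le hbdd (mem_image_of_mem f hx)
  have hex : ∀ n : ℕ, ∃ x ∈ s, f x < m + 1 / ((n : ℝ) + 1) := fun n => by
    obtain ⟨_, ⟨x, hx, rfl⟩, h⟩ := exists_lt_of_csInf_lt (hne.image f)
      (show sInf (f '' s) < m + 1 / ((n : ℝ) + 1) by
        have : (0 : ℝ) < 1 / ((n : ℝ) + 1) := by positivity
        linarith)
    exact ⟨x, hx, h⟩
  choose x hxs hx using hex
  have hcau : CauchySeq x := by
    refine Metric.cauchySeq_iff'.2 fun e he => ?_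
    obtain ⟨N, hN⟩ := exists_nat_one_div_lt (show 0 < κ * e ^ 2 by positivity)
    refine ⟨N, fun n hn => ?_⟩
    -- The midpoint lies in `s`, so its value is at least `m`; strong convexity then makes the
    -- minimizing sequence Cauchy.
    have h1 := hmid (x n) (x N)
    have h2 := hle _ (hconv _ (hxs n) _ (hxs N))
    have h3 : (1 : ℝ) / ((n : ℝ) + 1) ≤ 1 / ((N : ℝ) + 1) := Nat.one_div_le_one_div hn
    rw [dist_eq_norm]
    refine lt_of_pow_lt_pow_left₀ 2 he.le ?_
    refine lt_of_mul_lt_mul_left ?_ hκ.le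
    linarith [hx n, hx N]
  obtain ⟨a, ha⟩ := cauchySeq_tendsto_of_complete hcau
  have has : a ∈ s := hs.mem_of_tendsto ha (Filter.Eventually.of_forall hxs)
  have hfa : f a ≤ m := by
    have h1 := (hf.tendsto a).comp ha
    have h2 := tendsto_one_div_add_atTop_nhds_zero_nat (𝕜 := ℝ) |>.const_add m
    rw [add_zero] at h2
    exact le_of_tendsto_of_tendsto' h1 h2 fun n => (hx n).le
  exact ⟨a, has, fun y hy => hfa.trans (hle y hy)⟩

namespace RateIndependentSystem

variable {Z V X : Type*}
  [NormedAddCommGroup Z] [InnerProductSpace ℝ Z]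
  [NormedAddCommGroup V] [InnerProductSpace ℝ V]
  [NormedAddCommGroup X] [NormedSpace ℝ X]
  {S : RateIndependentSystem Z V X} {κ L ρ c : ℝ}

/-- Uniform convexity replaces compactness. The modulus is `κ/8 = κ/2 · (1/2)²`, since each point is
at distance `‖x - y‖ / 2` from the midpoint; the tangent at `0` gives the lower bound. -/
theorem Regular.exists_minimizer [CompleteSpace Z] (h : S.Regular κ L ρ c) {τ : ℝ} (hτ : 0 < τ)
    (t : ℝ) (z : Z) : ∃ x : Z, ‖S.ι (x - z)‖ ≤ τ ∧ ∀ w : Z, ‖S.ι (w - z)‖ ≤ τ →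
      S.energy t x + S.R (S.ι (x - z)) ≤ S.energy t w + S.R (S.ι (w - z)) := by
  have hκ := h.κ_pos
  have ec : Continuous (S.energy t) :=
    continuous_iff_continuousAt.2 fun x => (h.hasFDerivAt t x).continuousAt
  have dc : Continuous fun w => S.diss (w - z) := h.continuous_diss.comp (continuous_sub_right z)
  have ic : Continuous fun w => ‖S.ι (w - z)‖ := (S.ι.continuous.comp (continuous_sub_right z)).norm
  refine exists_forall_le_of_midpoint (f := fun w => S.energy t w + S.diss (w - z))
    (s := {w | ‖S.ι (w - z)‖ ≤ τ}) (κ := κ / 8)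
    (B := S.energy t 0 - ‖S.dEnergy t 0‖ ^ 2 / (2 * κ)) (by positivity) (ec.add dc)
    (fun x => ?_) (fun x y => ?_) (isClosed_le ic continuous_const) ⟨z, by simpa using hτ.le⟩
    fun x hx y hy => ?_
  · have h1 := h.tangent_le t 0 x
    have h2 := (abs_le.1 ((S.dEnergy t 0).le_opNorm x)).1
    have h3 := h.diss_nonneg (x - z)
    rw [sub_zero] at h1
    have h4 : ‖S.dEnergy t 0‖ * ‖x‖ - κ / 2 * ‖x‖ ^ 2 ≤ ‖S.dEnergy t 0‖ ^ 2 / (2 * κ) := by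
      rw [le_div_iff₀ (by positivity)]
      nlinarith [sq_nonneg (‖S.dEnergy t 0‖ - κ * ‖x‖)]
    linarith
  · set m := (1 / 2 : ℝ) • (x + y) with hm
    have h1 := h.tangent_le t m x
    have h2 := h.tangent_le t m y
    have ex : x - m = (1 / 2 : ℝ) • (x - y) := by rw [hm]; module
    have ey : y - m = -((1 / 2 : ℝ) • (x - y)) := by rw [hm]; module
    rw [ex] at h1
    rw [ey, map_neg, norm_neg] at h2
    rw [norm_smul, Real.norm_of_nonneg (by norm_num)] at h1 h2
    have h3 := h.diss_add_le ((1 / 2 : ℝ) • (x - z)) ((1 / 2 : ℝ) • (y - z))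
    rw [h.diss_smul _ (by norm_num), h.diss_smul _ (by norm_num)] at h3
    have em : (1 / 2 : ℝ) • (x - z) + (1 / 2 : ℝ) • (y - z) = m - z := by rw [hm]; module
    rw [em] at h3
    nlinarith
  · have em : (1 / 2 : ℝ) • (x + y) - z = (1 / 2 : ℝ) • (x - z) + (1 / 2 : ℝ) • (y - z) := by module
    simp only [mem_ofPred_eq] at hx hy ⊢
    rw [em, map_add, map_smul, map_smul]
    refine (norm_add_le _ _).trans ?_
    rw [norm_smul, norm_smul, Real.norm_of_nonneg (by norm_num)]
    linarith

theorem Regular.exists_scheme [CompleteSpace Z] (h : S.Regular κ L ρ c) {τ : ℝ} (hτ : 0 < τ) :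
    ∃ (t : ℕ → ℝ) (z : ℕ → Z), S.IsLocalMinScheme τ t z := by
  choose x hx hmin using h.exists_minimizer hτ
  let u : ℕ → ℝ × Z := fun n => Nat.rec (0, S.z₀)
    (fun _ p => (min (p.1 + τ - ‖S.ι (x p.1 p.2 - p.2)‖) S.T, x p.1 p.2)) n
  exact ⟨fun n => (u n).1, fun n => (u n).2,
    { t_zero := rfl
      z_zero := rfl
      feasible := fun k => hx _ _
      minimal := fun k => hmin _ _
      t_succ := fun k => rfl }⟩

/-! ### Multipliers, a priori bounds and arrival at the final time. -/

/-- The multipliers of the constraint `‖z_{k+1} - z_k‖_V ≤ τ`, in dual norm. -/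
noncomputable def multiplier (S : RateIndependentSystem Z V X) (τ : ℝ) (t : ℕ → ℝ) (z : ℕ → Z) :
    ℕ → ℝ
  -- The initial state is stable, so it behaves like an iterate with inactive constraint.
  | 0 => 0
  | k + 1 => -(S.dEnergy (t k) (z (k + 1)) (z (k + 1) - z k) + S.diss (z (k + 1) - z k)) / τ

namespace IsLocalMinScheme

variable {τ : ℝ} {t : ℕ → ℝ} {z : ℕ → Z}

theorem t_mem (hs : S.IsLocalMinScheme τ t z) (hT : 0 < S.T) (k : ℕ) : t k ∈ Icc 0 S.T := by
  induction k with
  | zero => rw [hs.t_zero]; exact ⟨le_rfl, hT.le⟩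
  | succ k ih =>
    rw [hs.t_succ]
    have := hs.feasible k
    exact ⟨le_min (by linarith [ih.1]) hT.le, min_le_right _ _⟩

theorem t_le_succ (hs : S.IsLocalMinScheme τ t z) (hT : 0 < S.T) (k : ℕ) : t k ≤ t (k + 1) := by
  rw [hs.t_succ]
  have := hs.feasible k
  exact le_min (by linarith) (hs.t_mem hT k).2

theorem t_monotone (hs : S.IsLocalMinScheme τ t z) (hT : 0 < S.T) : Monotone t :=
  monotone_nat_of_le_succ (hs.t_le_succ hT)

theorem t_pred_le (hs : S.IsLocalMinScheme τ t z) (hT : 0 < S.T) (k : ℕ) : t (k - 1) ≤ t k :=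
  hs.t_monotone hT (Nat.sub_le k 1)

theorem t_sub_pred_le (hs : S.IsLocalMinScheme τ t z) (hτ : 0 < τ) (k : ℕ) :
    t k - t (k - 1) ≤ τ := by
  cases k with
  | zero => simpa using hτ.le
  | succ k =>
    rw [Nat.add_sub_cancel, hs.t_succ]
    have := min_le_left (t k + τ - ‖S.ι (z (k + 1) - z k)‖) S.T
    have := norm_nonneg (S.ι (z (k + 1) - z k))
    linarith

/-- The first-order optimality condition. -/
theorem variational (hs : S.IsLocalMinScheme τ t z) (h : S.Regular κ L ρ c) (k : ℕ) {w : Z}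
    (hw : ‖S.ι w‖ ≤ τ) :
    0 ≤ S.dEnergy (t k) (z (k + 1)) (w - (z (k + 1) - z k)) + S.diss w -
      S.diss (z (k + 1) - z k) := by
  set x := z (k + 1) with hx
  set Δ := x - z k with hΔ
  have hd : HasDerivAt (fun r : ℝ => S.energy (t k) (x + r • (w - Δ)))
      (S.dEnergy (t k) x (w - Δ)) 0 := by
    have h1 : HasDerivAt (fun r : ℝ => x + r • (w - Δ)) (w - Δ) 0 := by
      simpa using ((hasDerivAt_id (0 : ℝ)).smul_const (w - Δ)).const_add x
    have h2 : HasFDerivAt (S.energy (t k)) (S.dEnergy (t k) x) (x + (0 : ℝ) • (w - Δ)) := by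
      rw [zero_smul, add_zero]; exact h.hasFDerivAt (t k) x
    exact h2.comp_hasDerivAt (0 : ℝ) h1
  have hsl := (hasDerivAt_iff_tendsto_slope_zero.1 hd).mono_left
    (nhdsWithin_mono (0 : ℝ) (fun x (hx : 0 < x) => hx.ne') :
      nhdsWithin (0 : ℝ) (Ioi 0) ≤ nhdsWithin 0 {0}ᶜ)
  have hev : Ioo (0 : ℝ) 1 ∈ nhdsWithin (0 : ℝ) (Ioi 0) := Ioo_mem_nhdsGT one_pos
  have key : S.diss Δ - S.diss w ≤ S.dEnergy (t k) x (w - Δ) := by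
    refine ge_of_tendsto hsl ?_
    filter_upwards [hev] with r hr
    -- The competitor moves the increment from `Δ` towards `w`; it stays admissible since the
    -- constraint set is convex.
    have e : x + r • (w - Δ) - z k = (1 - r) • Δ + r • w := by rw [hΔ]; module
    have hr1 : 0 ≤ 1 - r := by linarith [hr.2]
    have hΔτ : ‖S.ι Δ‖ ≤ τ := hs.feasible k
    have hm := hs.minimal k (x + r • (w - Δ)) (by
      rw [e, map_add, map_smul, map_smul]
      refine (norm_add_le _ _).trans ?_
      rw [norm_smul, norm_smul, Real.norm_of_nonneg hr1, Real.norm_of_nonneg hr.1.le]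
      nlinarith [hr.1])
    rw [e] at hm
    have hm' : S.energy (t k) x + S.diss Δ ≤
        S.energy (t k) (x + r • (w - Δ)) + S.diss ((1 - r) • Δ + r • w) := hm
    have h4 := h.diss_add_le ((1 - r) • Δ) (r • w)
    rw [h.diss_smul _ hr1, h.diss_smul _ hr.1.le] at h4
    simp only [zero_add, zero_smul, add_zero, smul_eq_mul]
    rw [le_inv_mul_iff₀ hr.1]
    linarith
  linarith

theorem multiplier_nonneg (hs : S.IsLocalMinScheme τ t z) (h : S.Regular κ L ρ c) (hτ : 0 < τ)
    (k : ℕ) : 0 ≤ S.multiplier τ t z k := by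
  cases k with
  | zero => exact le_rfl
  | succ k =>
    have h1 := hs.variational h k (w := 0) (by simpa using hτ.le)
    rw [zero_sub, map_neg, h.diss_zero] at h1
    exact div_nonneg (by linarith) hτ.le

/-- Complementarity: the multiplier vanishes if the constraint is not active. -/
theorem multiplier_eq_zero (hs : S.IsLocalMinScheme τ t z) (h : S.Regular κ L ρ c) (hτ : 0 < τ)
    {k : ℕ} (hk : ‖S.ι (z (k + 1) - z k)‖ < τ) : S.multiplier τ t z (k + 1) = 0 := by
  refine le_antisymm ?_ (hs.multiplier_nonneg h hτ _)
  set Δ := z (k + 1) - z k with hΔ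
  set r := (τ - ‖S.ι Δ‖) / τ with hr
  have hr0 : 0 < r := div_pos (sub_pos.2 hk) hτ
  have hrτ : r * τ = τ - ‖S.ι Δ‖ := by rw [hr]; field_simp
  -- An inactive constraint leaves room to prolong the step itself; `r` is small enough for `‖ιΔ‖ +
  -- r τ ≤ τ`.
  have h1 := hs.variational h k (w := (1 + r) • Δ) (by
    rw [map_smul, norm_smul, Real.norm_of_nonneg (by linarith)]
    nlinarith)
  rw [h.diss_smul _ (by linarith), ← hΔ, show (1 + r) • Δ - Δ = r • Δ by module, map_smul,
    smul_eq_mul] at h1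
  have h2 : 0 ≤ r * (S.dEnergy (t k) (z (k + 1)) Δ + S.diss Δ) := by linarith
  have h3 := nonneg_of_mul_nonneg_right h2 hr0
  exact div_nonpos_of_nonpos_of_nonneg (by linarith) hτ.le

theorem dissipation_eq (hs : S.IsLocalMinScheme τ t z) (h : S.Regular κ L ρ c) (hτ : 0 < τ)
    (k : ℕ) : S.dEnergy (t k) (z (k + 1)) (z (k + 1) - z k) + S.diss (z (k + 1) - z k) =
      -(S.multiplier τ t z (k + 1) * ‖S.ι (z (k + 1) - z k)‖) := by
  have e : S.dEnergy (t k) (z (k + 1)) (z (k + 1) - z k) + S.diss (z (k + 1) - z k) =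
      -(S.multiplier τ t z (k + 1) * τ) := by
    rw [multiplier]; field_simp
  rcases (hs.feasible k).lt_or_eq with hlt | heq
  · rw [e, hs.multiplier_eq_zero h hτ hlt]; ring
  · rw [e, heq]

/-- Scaling `w` to `V`-norm `τ` makes it admissible in `variational`. The force is taken at `t (k -
1)`, the time used in the step that produced `z k`; for `k = 0` truncated subtraction gives time
`0`. -/
theorem stable_up_to_multiplier (hs : S.IsLocalMinScheme τ t z) (h : S.Regular κ L ρ c)
    (hτ : 0 < τ) (k : ℕ) (w : Z) :
    0 ≤ S.dEnergy (t (k - 1)) (z k) w + S.diss w + S.multiplier τ t z k * ‖S.ι w‖ := by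
  cases k with
  | zero =>
    rw [Nat.zero_sub, hs.t_zero, hs.z_zero, multiplier, zero_mul, add_zero]
    exact h.initial_stable w
  | succ k =>
    rw [Nat.add_sub_cancel]
    rcases eq_or_ne w 0 with rfl | hw
    · simp [h.diss_zero]
    have hw' : 0 < ‖S.ι w‖ := norm_pos_iff.2 fun h0 =>
      hw (h.ι_injective (h0.trans (map_zero S.ι).symm))
    have hq : 0 < τ / ‖S.ι w‖ := by positivity
    have h1 := hs.variational h k (w := (τ / ‖S.ι w‖) • w) (by
      rw [map_smul, norm_smul, Real.norm_of_nonneg hq.le, div_mul_cancel₀ _ hw'.ne'])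
    rw [map_sub, map_smul, h.diss_smul _ hq.le, smul_eq_mul] at h1
    have e : S.dEnergy (t k) (z (k + 1)) (z (k + 1) - z k) + S.diss (z (k + 1) - z k) =
        -(S.multiplier τ t z (k + 1) * τ) := by
      rw [multiplier]; field_simp
    have h2 : 0 ≤ (τ / ‖S.ι w‖) * (S.dEnergy (t k) (z (k + 1)) w + S.diss w +
        S.multiplier τ t z (k + 1) * ‖S.ι w‖) := by
      have : (τ / ‖S.ι w‖) * (S.multiplier τ t z (k + 1) * ‖S.ι w‖) =
          S.multiplier τ t z (k + 1) * τ := by field_simp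
      rw [mul_add, this]
      linarith
    exact nonneg_of_mul_nonneg_right h2 hq

/-- Approximate stability of `z k`, tested with the next increment, is subtracted from the
dissipation equality of that step. Strong monotonicity supplies `κ`; the change of load between `t
(k - 1)` and `t k` supplies `L`. -/
theorem step_estimate (hs : S.IsLocalMinScheme τ t z) (h : S.Regular κ L ρ c) (hτ : 0 < τ)
    (k : ℕ) : κ * ‖z (k + 1) - z k‖ ^ 2 + S.multiplier τ t z (k + 1) * ‖S.ι (z (k + 1) - z k)‖ ≤
      (S.multiplier τ t z k + L * (t k - t (k - 1))) * ‖S.ι (z (k + 1) - z k)‖ := by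
  have h1 := hs.stable_up_to_multiplier h hτ k (z (k + 1) - z k)
  have h2 := hs.dissipation_eq h hτ k
  have h3 := h.monotone (t k) (z (k + 1)) (z k)
  rw [h.dEnergy_apply (t (k - 1)) (t k) (z k)] at h3
  have h4 := (abs_le.1 (h.load_le _ (hs.t_mem h.T_pos (k - 1)) _ (hs.t_mem h.T_pos k)
    (z (k + 1) - z k))).2
  rw [abs_of_nonneg (sub_nonneg.2 (hs.t_pred_le h.T_pos k))] at h4
  linarith

theorem step_data_nonneg (hs : S.IsLocalMinScheme τ t z) (h : S.Regular κ L ρ c) (hτ : 0 < τ)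
    (k : ℕ) : 0 ≤ S.multiplier τ t z k + L * (t k - t (k - 1)) :=
  add_nonneg (hs.multiplier_nonneg h hτ k)
    (mul_nonneg h.L_nonneg (sub_nonneg.2 (hs.t_pred_le h.T_pos k)))

/-- The multipliers decrease by a fixed multiple of the length of the steps. -/
theorem multiplier_succ_le (hs : S.IsLocalMinScheme τ t z) (h : S.Regular κ L ρ c) (hτ : 0 < τ)
    (k : ℕ) : S.multiplier τ t z (k + 1) + κ / c ^ 2 * ‖S.ι (z (k + 1) - z k)‖ ≤
      S.multiplier τ t z k + L * (t k - t (k - 1)) := by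
  have hc := h.c_pos
  have hκ := h.κ_pos
  rcases (norm_nonneg (S.ι (z (k + 1) - z k))).eq_or_lt with h0 | hpos
  · rw [hs.multiplier_eq_zero h hτ (by rw [← h0]; exact hτ), ← h0, mul_zero, add_zero]
    exact hs.step_data_nonneg h hτ k
  · have h1 := hs.step_estimate h hτ k
    have h2 := h.norm_ι_le (z (k + 1) - z k)
    have h3 : κ / c ^ 2 * ‖S.ι (z (k + 1) - z k)‖ ^ 2 ≤ κ * ‖z (k + 1) - z k‖ ^ 2 := by
      rw [div_mul_eq_mul_div, div_le_iff₀ (by positivity)]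
      have : ‖S.ι (z (k + 1) - z k)‖ ^ 2 ≤ (c * ‖z (k + 1) - z k‖) ^ 2 := by gcongr
      calc κ * ‖S.ι (z (k + 1) - z k)‖ ^ 2 ≤ κ * (c * ‖z (k + 1) - z k‖) ^ 2 := by gcongr
        _ = _ := by ring
    refine le_of_mul_le_mul_right ?_ hpos
    nlinarith

theorem norm_step_le (hs : S.IsLocalMinScheme τ t z) (h : S.Regular κ L ρ c) (hτ : 0 < τ)
    (k : ℕ) : ‖z (k + 1) - z k‖ ≤
      c / κ * (S.multiplier τ t z k + L * (t k - t (k - 1))) := by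
  have hc := h.c_pos
  have hκ := h.κ_pos
  have hd := hs.step_data_nonneg h hτ k
  rcases (norm_nonneg (z (k + 1) - z k)).eq_or_lt with h0 | hpos
  · rw [← h0]; positivity
  · have h1 := hs.step_estimate h hτ k
    have h2 := mul_le_mul_of_nonneg_left (h.norm_ι_le (z (k + 1) - z k)) hd
    have h3 := mul_nonneg (hs.multiplier_nonneg h hτ (k + 1)) (norm_nonneg (S.ι (z (k + 1) - z k)))
    rw [div_mul_eq_mul_div, le_div_iff₀ hκ]
    refine le_of_mul_le_mul_right ?_ hpos
    nlinarith

theorem multiplier_eq_zero_of_progress (hs : S.IsLocalMinScheme τ t z) (h : S.Regular κ L ρ c)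
    (hτ : 0 < τ) {k : ℕ} (hk : t (k - 1) < t k) : S.multiplier τ t z k = 0 := by
  cases k with
  | zero => rfl
  | succ k =>
    refine hs.multiplier_eq_zero h hτ ?_
    rw [Nat.add_sub_cancel, hs.t_succ] at hk
    have := hk.trans_le (min_le_left _ _)
    linarith

/-- The two summands are never both positive: after time progress the multiplier vanishes, and
without progress the sum does not increase. -/
theorem step_data_le (hs : S.IsLocalMinScheme τ t z) (h : S.Regular κ L ρ c) (hτ : 0 < τ)
    (k : ℕ) : S.multiplier τ t z k + L * (t k - t (k - 1)) ≤ L * S.T := by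
  have hc := h.c_pos
  have hκ := h.κ_pos
  have hL := h.L_nonneg
  induction k with
  | zero => simpa [multiplier] using mul_nonneg h.L_nonneg h.T_pos.le
  | succ k ih =>
    rcases (hs.t_pred_le h.T_pos (k + 1)).eq_or_lt with heq | hlt
    · rw [heq, sub_self, mul_zero, add_zero]
      have h1 := hs.multiplier_succ_le h hτ k
      have : 0 ≤ κ / c ^ 2 * ‖S.ι (z (k + 1) - z k)‖ := by positivity
      linarith
    · rw [hs.multiplier_eq_zero_of_progress h hτ hlt, zero_add]
      have h1 := (hs.t_mem h.T_pos (k + 1)).2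
      have h2 := (hs.t_mem h.T_pos (k + 1 - 1)).1
      gcongr
      linarith

/-- The iterates are bounded, uniformly with respect to the step size. -/
theorem norm_le (hs : S.IsLocalMinScheme τ t z) (h : S.Regular κ L ρ c) (hτ : 0 < τ) (k : ℕ) :
    ‖z k‖ ≤ (ρ * c + L * S.T * c + ‖S.dEnergy 0 0‖ + L * c * S.T) / κ := by
  have hc := h.c_pos
  have hL := h.L_nonneg
  have hT := h.T_pos
  refine h.norm_le_of_stable (hs.t_mem h.T_pos (k - 1)) (by positivity) fun w => ?_
  have h1 := hs.stable_up_to_multiplier h hτ k w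
  have h2 := hs.step_data_le h hτ k
  have h3 := mul_nonneg h.L_nonneg (sub_nonneg.2 (hs.t_pred_le h.T_pos k))
  have h4 : S.multiplier τ t z k * ‖S.ι w‖ ≤ L * S.T * (c * ‖w‖) := by
    have := h.norm_ι_le w
    gcongr
    linarith
  linarith

/-- The final time is reached. -/
theorem exists_t_eq (hs : S.IsLocalMinScheme τ t z) (h : S.Regular κ L ρ c) (hτ : 0 < τ) :
    ∃ k, t k = S.T := by
  by_contra! hne
  have hlt : ∀ k, t k < S.T := fun k => lt_of_le_of_ne (hs.t_mem h.T_pos k).2 (hne k)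
  have hc := h.c_pos
  have hκ := h.κ_pos
  set θ := κ / c ^ 2 with hθ
  have hθ0 : 0 < θ := by positivity
  have step : ∀ k, t (k + 1) = t k + τ - ‖S.ι (z (k + 1) - z k)‖ := fun k => by
    have h1 := hs.t_succ k
    rcases min_choice (t k + τ - ‖S.ι (z (k + 1) - z k)‖) S.T with h2 | h2
    · rw [h1, h2]
    · exact absurd (h1.trans h2) (hne _)
  -- While `T` is not reached, `n τ - t n` is the total length of the first `n` steps in `V`. It is
  -- paid for by the load, so `n τ` stays bounded, a contradiction.
  have sum : ∀ n : ℕ, S.multiplier τ t z n + L * (t n - t (n - 1)) +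
      θ * (n * τ - t n) ≤ L * t n := by
    intro n
    induction n with
    | zero => simp [multiplier, hs.t_zero]
    | succ n ih =>
      have h1 := hs.multiplier_succ_le h hτ n
      have h2 := step n
      rw [Nat.add_sub_cancel]
      push_cast
      have h3 : ‖S.ι (z (n + 1) - z n)‖ = τ - (t (n + 1) - t n) := by linarith
      rw [h3] at h1
      nlinarith
  obtain ⟨n, hn⟩ := exists_nat_gt ((S.T + L * S.T / θ) / τ)
  rw [div_lt_iff₀ hτ] at hn
  have h1 := sum n
  have h2 := hs.step_data_nonneg h hτ n
  have h3 := hlt n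
  have h4 : L * t n ≤ L * S.T := mul_le_mul_of_nonneg_left h3.le h.L_nonneg
  have h5 : θ * (n * τ - t n) ≤ L * S.T := by linarith
  have h6 : (n * τ - t n) ≤ L * S.T / θ := by
    rw [le_div_iff₀ hθ0]; linarith
  linarith

end IsLocalMinScheme

end RateIndependentSystem

/-! ### Stalls: their length, displacement and dissipation. -/

namespace RateIndependentSystem

variable {Z V X : Type*}
  [NormedAddCommGroup Z] [InnerProductSpace ℝ Z]
  [NormedAddCommGroup V] [InnerProductSpace ℝ V]
  [NormedAddCommGroup X] [NormedSpace ℝ X]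
  {S : RateIndependentSystem Z V X} {κ L ρ c : ℝ}

theorem Regular.abs_dEnergy_sub_le (h : S.Regular κ L ρ c) {b Λ : ℝ}
    (hΛ : ∀ x ∈ Metric.closedBall (0 : Z) b, ∀ y ∈ Metric.closedBall (0 : Z) b, ∀ t v,
      |S.dEnergy t x v - S.dEnergy t y v| ≤ Λ * ‖x - y‖ * ‖v‖) {s t : ℝ}
    (hs : s ∈ Icc 0 S.T) (ht : t ∈ Icc 0 S.T) {x y : Z} (hx : ‖x‖ ≤ b) (hy : ‖y‖ ≤ b) (v : Z) :
    |S.dEnergy s x v - S.dEnergy t y v| ≤ (Λ * ‖x - y‖ + L * c * |s - t|) * ‖v‖ := by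
  have h1 := hΛ x (mem_closedBall_zero_iff.2 hx) y (mem_closedBall_zero_iff.2 hy) s v
  have h2 := h.load_le_norm ht hs v
  have h3 := h.dEnergy_apply t s y v
  rw [abs_le] at h1 h2 ⊢
  constructor <;> linarith [h1.1, h1.2, h2.1, h2.2]

/-- The steps from `k₀` to `k₁` start with inactive constraint, and all of them but possibly the
last one make no progress in time. -/
structure IsStall (S : RateIndependentSystem Z V X) (τ : ℝ) (t : ℕ → ℝ) (z : ℕ → Z)
    (k₀ k₁ : ℕ) : Prop where
  lt : k₀ < k₁
  multiplier_eq : S.multiplier τ t z k₀ = 0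
  active : ∀ k, k₀ ≤ k → k + 1 < k₁ → ‖S.ι (z (k + 1) - z k)‖ = τ ∧ t (k + 1) = t k

namespace IsStall

variable {τ : ℝ} {t : ℕ → ℝ} {z : ℕ → Z} {k₀ k₁ : ℕ}

theorem t_eq (hst : S.IsStall τ t z k₀ k₁) {j : ℕ} (hj : k₀ + j < k₁) : t (k₀ + j) = t k₀ := by
  induction j with
  | zero => rfl
  | succ j ih =>
    rw [← ih (by omega)]
    exact (hst.active (k₀ + j) (by omega) hj).2

/-- Within a stall the load is frozen and every active step has length exactly `τ`, so each lowers
the left-hand budget by `κ τ / c²`. -/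
theorem step_data_le (hst : S.IsStall τ t z k₀ k₁) (hs : S.IsLocalMinScheme τ t z)
    (h : S.Regular κ L ρ c) (hτ : 0 < τ) {j : ℕ} (hj : k₀ + j < k₁) :
    S.multiplier τ t z (k₀ + j) + L * (t (k₀ + j) - t (k₀ + j - 1)) + j * (κ / c ^ 2 * τ) ≤
      L * (t k₀ - t (k₀ - 1)) := by
  induction j with
  | zero => simp [hst.multiplier_eq]
  | succ j ih =>
    have h1 := ih (by omega)
    have h2 := hs.multiplier_succ_le h hτ (k₀ + j)
    obtain ⟨h3, h4⟩ := hst.active (k₀ + j) (by omega) hj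
    rw [h3] at h2
    rw [← add_assoc, Nat.add_sub_cancel, h4, sub_self, mul_zero, add_zero]
    push_cast
    linarith

/-- Stalls last a bounded number of steps. -/
theorem length_le (hst : S.IsStall τ t z k₀ k₁) (hs : S.IsLocalMinScheme τ t z)
    (h : S.Regular κ L ρ c) (hτ : 0 < τ) : k₁ ≤ k₀ + (⌈L * c ^ 2 / κ⌉₊ + 1) := by
  have hc := h.c_pos
  have hκ := h.κ_pos
  obtain ⟨j, rfl⟩ : ∃ j, k₁ = k₀ + j + 1 := ⟨k₁ - k₀ - 1, by have := hst.lt; omega⟩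
  have h1 := hst.step_data_le hs h hτ (j := j) (by omega)
  have h2 := hs.step_data_nonneg h hτ (k₀ + j)
  have h3 := mul_le_mul_of_nonneg_left (hs.t_sub_pred_le hτ k₀) h.L_nonneg
  have h4 : (j : ℝ) ≤ L * c ^ 2 / κ := by
    rw [le_div_iff₀ hκ]
    -- Budget and cost per step are both proportional to `τ`, which cancels: the bound is uniform in
    -- `τ`.
    have h5 : (j * κ / c ^ 2) * τ ≤ L * τ := by
      have : (j : ℝ) * (κ / c ^ 2 * τ) = j * κ / c ^ 2 * τ := by ring
      linarith
    have h6 := le_of_mul_le_mul_right h5 hτ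
    rwa [div_le_iff₀ (by positivity)] at h6
  have h5 : j ≤ ⌈L * c ^ 2 / κ⌉₊ := by exact_mod_cast h4.trans (Nat.le_ceil _)
  omega

theorem norm_step_le (hst : S.IsStall τ t z k₀ k₁) (hs : S.IsLocalMinScheme τ t z)
    (h : S.Regular κ L ρ c) (hτ : 0 < τ) {j : ℕ} (hj : k₀ + j < k₁) :
    ‖z (k₀ + j + 1) - z (k₀ + j)‖ ≤ c / κ * (L * (t k₀ - t (k₀ - 1))) := by
  have hc := h.c_pos
  have hκ := h.κ_pos
  refine (hs.norm_step_le h hτ _).trans ?_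
  have h1 := hst.step_data_le hs h hτ hj
  have h2 : (0 : ℝ) ≤ j * (κ / c ^ 2 * τ) := by positivity
  gcongr
  linarith

theorem norm_sub_le (hst : S.IsStall τ t z k₀ k₁) (hs : S.IsLocalMinScheme τ t z)
    (h : S.Regular κ L ρ c) (hτ : 0 < τ) {i j : ℕ} (hij : k₀ + i + j ≤ k₁) :
    ‖z (k₀ + i + j) - z (k₀ + i)‖ ≤ j * (c / κ * (L * (t k₀ - t (k₀ - 1)))) := by
  induction j with
  | zero => simp
  | succ j ih =>
    have h1 := ih (by omega)
    have h2 := hst.norm_step_le hs h hτ (j := i + j) (by omega)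
    have h3 := norm_sub_le_norm_sub_add_norm_sub (z (k₀ + i + (j + 1))) (z (k₀ + i + j))
      (z (k₀ + i))
    have e : k₀ + (i + j) = k₀ + i + j := by omega
    rw [e] at h2
    push_cast
    have e2 : k₀ + i + (j + 1) = k₀ + i + j + 1 := by omega
    rw [e2] at h3 ⊢
    linarith

/-- Each step dissipates correctly with the force at its own end point. Moving that point to `z k₁`,
the end of the stall, costs a product of two displacements, hence an error quadratic in the
preceding time progress. -/
theorem diss_add_dEnergy_le (hst : S.IsStall τ t z k₀ k₁) (hs : S.IsLocalMinScheme τ t z)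
    (h : S.Regular κ L ρ c) (hτ : 0 < τ) {b Λ : ℝ} (hΛ0 : 0 ≤ Λ) (hb : ∀ k, ‖z k‖ ≤ b)
    (hΛ : ∀ x ∈ Metric.closedBall (0 : Z) b, ∀ y ∈ Metric.closedBall (0 : Z) b, ∀ t v,
      |S.dEnergy t x v - S.dEnergy t y v| ≤ Λ * ‖x - y‖ * ‖v‖) {j : ℕ} (hj : k₀ + j ≤ k₁) :
    S.diss (z (k₀ + j) - z k₀) + S.dEnergy (t k₀) (z k₁) (z (k₀ + j) - z k₀) ≤
      j * (Λ * ((k₁ - k₀ : ℕ) * (c / κ * (L * (t k₀ - t (k₀ - 1))))) *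
        (c / κ * (L * (t k₀ - t (k₀ - 1))))) := by
  have hc := h.c_pos
  have hκ := h.κ_pos
  have hL := h.L_nonneg
  have hh := sub_nonneg.2 (hs.t_pred_le h.T_pos k₀)
  set d := c / κ * (L * (t k₀ - t (k₀ - 1))) with hd
  have hd0 : 0 ≤ d := by positivity
  induction j with
  | zero => simp [h.diss_zero]
  | succ j ih =>
    have h1 := ih (by omega)
    set Δ := z (k₀ + j + 1) - z (k₀ + j) with hΔ
    have e : z (k₀ + (j + 1)) - z k₀ = (z (k₀ + j) - z k₀) + Δ := by
      rw [hΔ, ← add_assoc]; abel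
    have h2 := hs.dissipation_eq h hτ (k₀ + j)
    rw [hst.t_eq (by omega)] at h2
    have h3 := mul_nonneg (hs.multiplier_nonneg h hτ (k₀ + j + 1)) (norm_nonneg (S.ι Δ))
    have h4 := (abs_le.1 (hΛ _ (mem_closedBall_zero_iff.2 (hb k₁)) _
      (mem_closedBall_zero_iff.2 (hb (k₀ + j + 1))) (t k₀) Δ)).2
    have h5 : ‖z k₁ - z (k₀ + j + 1)‖ ≤ (k₁ - k₀ : ℕ) * d := by
      have := hst.norm_sub_le hs h hτ (i := j + 1) (j := k₁ - k₀ - (j + 1)) (by omega)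
      have e1 : k₀ + (j + 1) + (k₁ - k₀ - (j + 1)) = k₁ := by omega
      rw [e1, ← add_assoc, ← hd] at this
      exact this.trans (mul_le_mul_of_nonneg_right (by exact_mod_cast Nat.sub_le _ _) hd0)
    have h6 : ‖Δ‖ ≤ d := hst.norm_step_le hs h hτ (by omega)
    have h7 : Λ * ‖z k₁ - z (k₀ + j + 1)‖ * ‖Δ‖ ≤ Λ * ((k₁ - k₀ : ℕ) * d) * d := by gcongr
    have h8 := h.diss_add_le (z (k₀ + j) - z k₀) Δ
    rw [e, map_add]
    push_cast
    linarith

theorem norm_sub_le_const (hst : S.IsStall τ t z k₀ k₁) (hs : S.IsLocalMinScheme τ t z)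
    (h : S.Regular κ L ρ c) (hτ : 0 < τ) :
    ‖z k₁ - z k₀‖ ≤ (⌈L * c ^ 2 / κ⌉₊ + 1 : ℕ) * (c / κ * L) * (t k₀ - t (k₀ - 1)) := by
  have hc := h.c_pos
  have hκ := h.κ_pos
  have hL := h.L_nonneg
  have hh := sub_nonneg.2 (hs.t_pred_le h.T_pos k₀)
  have hlt := hst.lt
  have h1 := hst.norm_sub_le hs h hτ (i := 0) (j := k₁ - k₀) (by omega)
  have e : k₀ + 0 + (k₁ - k₀) = k₁ := by omega
  rw [e, add_zero] at h1
  refine h1.trans ?_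
  have h2 := hst.length_le hs h hτ
  have h3 : ((k₁ - k₀ : ℕ) : ℝ) ≤ (⌈L * c ^ 2 / κ⌉₊ + 1 : ℕ) := by
    exact_mod_cast (by omega : k₁ - k₀ ≤ ⌈L * c ^ 2 / κ⌉₊ + 1)
  calc ((k₁ - k₀ : ℕ) : ℝ) * (c / κ * (L * (t k₀ - t (k₀ - 1))))
      ≤ (⌈L * c ^ 2 / κ⌉₊ + 1 : ℕ) * (c / κ * (L * (t k₀ - t (k₀ - 1)))) := by gcongr
    _ = _ := by ring

theorem dissipation_le_const (hst : S.IsStall τ t z k₀ k₁) (hs : S.IsLocalMinScheme τ t z)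
    (h : S.Regular κ L ρ c) (hτ : 0 < τ) {b Λ : ℝ} (hΛ0 : 0 ≤ Λ) (hb : ∀ k, ‖z k‖ ≤ b)
    (hΛ : ∀ x ∈ Metric.closedBall (0 : Z) b, ∀ y ∈ Metric.closedBall (0 : Z) b, ∀ t v,
      |S.dEnergy t x v - S.dEnergy t y v| ≤ Λ * ‖x - y‖ * ‖v‖) :
    S.diss (z k₁ - z k₀) + S.dEnergy (t k₀) (z k₁) (z k₁ - z k₀) ≤
      Λ * ((⌈L * c ^ 2 / κ⌉₊ + 1 : ℕ) * (c / κ * L)) ^ 2 * (t k₀ - t (k₀ - 1)) ^ 2 := by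
  have hc := h.c_pos
  have hκ := h.κ_pos
  have hL := h.L_nonneg
  have hh := sub_nonneg.2 (hs.t_pred_le h.T_pos k₀)
  have hlt := hst.lt
  have h1 := hst.diss_add_dEnergy_le hs h hτ hΛ0 hb hΛ (j := k₁ - k₀) (by omega)
  have e : k₀ + (k₁ - k₀) = k₁ := by omega
  rw [e] at h1
  refine h1.trans ?_
  have h2 := hst.length_le hs h hτ
  have h3 : ((k₁ - k₀ : ℕ) : ℝ) ≤ (⌈L * c ^ 2 / κ⌉₊ + 1 : ℕ) := by
    exact_mod_cast (by omega : k₁ - k₀ ≤ ⌈L * c ^ 2 / κ⌉₊ + 1)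
  set n : ℝ := ((k₁ - k₀ : ℕ) : ℝ) with hn
  have hn0 : 0 ≤ n := Nat.cast_nonneg _
  calc n * (Λ * (n * (c / κ * (L * (t k₀ - t (k₀ - 1))))) * (c / κ * (L * (t k₀ - t (k₀ - 1)))))
      = Λ * (n * (c / κ * L)) ^ 2 * (t k₀ - t (k₀ - 1)) ^ 2 := by ring
    _ ≤ _ := by gcongr

end IsStall

/-! ### Affine interpolation of nodes. -/

/-- Nodes `σ i` and states `w i`, stable at `σ i`, from which approximate solutions are
interpolated. -/
structure IsNodeData (S : RateIndependentSystem Z V X) (τ b K C : ℝ) (m : ℕ) (σ : ℕ → ℝ)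
    (w : ℕ → Z) : Prop where
  σ_zero : σ 0 = 0
  σ_last : σ m = S.T
  lt_succ : ∀ i < m, σ i < σ (i + 1)
  sub_le : ∀ i < m, σ (i + 1) - σ i ≤ τ
  w_zero : w 0 = S.z₀
  norm_le : ∀ i ≤ m, ‖w i‖ ≤ b
  norm_sub_le : ∀ i < m, ‖w (i + 1) - w i‖ ≤ K * (σ (i + 1) - σ i)
  stable : ∀ i ≤ m, ∀ v, 0 ≤ S.dEnergy (σ i) (w i) v + S.diss v
  dissipation : ∀ i < m, S.diss (w (i + 1) - w i) +
    S.dEnergy (σ (i + 1)) (w (i + 1)) (w (i + 1) - w i) ≤ C * (σ (i + 1) - σ i) ^ 2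

end RateIndependentSystem

section Pieces

variable {σ : ℕ → ℝ} {m : ℕ}

theorem exists_mem_Icc_succ (hm : 0 < m) {t : ℝ} (ht : t ∈ Icc (σ 0) (σ m)) :
    ∃ i < m, t ∈ Icc (σ i) (σ (i + 1)) := by
  induction m with
  | zero => omega
  | succ m ih =>
    rcases le_total t (σ m) with h | h
    · rcases Nat.eq_zero_or_pos m with rfl | hm'
      · exact ⟨0, by omega, ht⟩
      · obtain ⟨i, hi, hti⟩ := ih hm' ⟨ht.1, h⟩
        exact ⟨i, by omega, hti⟩
    · exact ⟨m, by omega, h, ht.2⟩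

/-- A transitive relation that holds on the pieces of a partition holds globally. -/
theorem rel_of_rel_on_pieces {H : ℝ → ℝ → Prop} (hrefl : ∀ t, H t t)
    (htrans : ∀ s u t, s ≤ u → u ≤ t → H s u → H u t → H s t)
    (hσ : ∀ i < m, σ i ≤ σ (i + 1))
    (hpiece : ∀ i < m, ∀ s ∈ Icc (σ i) (σ (i + 1)), ∀ t ∈ Icc (σ i) (σ (i + 1)), s ≤ t → H s t)
    {s t : ℝ} (hs : s ∈ Icc (σ 0) (σ m)) (ht : t ∈ Icc (σ 0) (σ m)) (hst : s ≤ t) : H s t := by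
  induction m generalizing s t with
  | zero =>
    have : s = t := by linarith [hs.1, hs.2, ht.1, ht.2]
    rw [this]; exact hrefl t
  | succ m ih =>
    have hle : σ 0 ≤ σ m := by
      clear * - hσ
      induction m with
      | zero => exact le_rfl
      | succ m ih =>
        exact (ih fun i hi => hσ i (by omega)).trans (hσ m (by omega))
    have hmm := hσ m (by omega)
    have ih' : ∀ {s t : ℝ}, s ∈ Icc (σ 0) (σ m) → t ∈ Icc (σ 0) (σ m) → s ≤ t → H s t :=
      fun hs ht hst => ih (fun i hi => hσ i (by omega)) (fun i hi => hpiece i (by omega)) hs ht hst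
    rcases le_total t (σ m) with h1 | h1
    · exact ih' ⟨hs.1, hst.trans h1⟩ ⟨ht.1, h1⟩ hst
    · rcases le_total (σ m) s with h2 | h2
      · exact hpiece m (by omega) s ⟨h2, hs.2⟩ t ⟨h1, ht.2⟩ hst
      · exact htrans s (σ m) t h2 h1 (ih' ⟨hs.1, h2⟩ ⟨hle, le_rfl⟩ h2)
          (hpiece m (by omega) _ ⟨le_rfl, hmm⟩ _ ⟨h1, ht.2⟩ h1)

end Pieces

namespace RateIndependentSystem

variable {Z V X : Type*}
  [NormedAddCommGroup Z] [InnerProductSpace ℝ Z]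
  [NormedAddCommGroup V] [InnerProductSpace ℝ V]
  [NormedAddCommGroup X] [NormedSpace ℝ X]
  {S : RateIndependentSystem Z V X} {κ L ρ c : ℝ}

/-- The affine interpolant of node data is an approximate solution. -/
theorem IsNodeData.isLipschitzApprox (h : S.Regular κ L ρ c) {τ b K C Λ : ℝ} (hC : 0 ≤ C)
    (hK : 1 ≤ K) (hΛ0 : 0 ≤ Λ) (hτ : 0 < τ)
    (hΛ : ∀ x ∈ Metric.closedBall (0 : Z) b, ∀ y ∈ Metric.closedBall (0 : Z) b, ∀ t v,
      |S.dEnergy t x v - S.dEnergy t y v| ≤ Λ * ‖x - y‖ * ‖v‖)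
    {m : ℕ} {σ : ℕ → ℝ} {w : ℕ → Z} (hn : S.IsNodeData τ b K C m σ w) {y : ℝ → Z}
    (hy : ∀ i < m, ∀ t ∈ Icc (σ i) (σ (i + 1)),
      y t = w i + ((t - σ i) / (σ (i + 1) - σ i)) • (w (i + 1) - w i)) :
    S.IsLipschitzApprox ((C + (Λ * K + L * c)) * τ) b K (Λ * K + L * c) y := by
  have hL := h.L_nonneg
  have hc := h.c_pos
  have hT := h.T_pos
  set Q := Λ * K + L * c with hQ
  have hQ0 : 0 ≤ Q := by positivity
  have hm : 0 < m := by
    rcases Nat.eq_zero_or_pos m with rfl | hm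
    · have := hn.σ_last; rw [hn.σ_zero] at this; exact absurd this hT.ne
    · exact hm
  have hσ : ∀ i < m, σ i ≤ σ (i + 1) := fun i hi => (hn.lt_succ i hi).le
  have hI : Icc 0 S.T = Icc (σ 0) (σ m) := by rw [hn.σ_zero, hn.σ_last]
  have hpos : ∀ i < m, 0 < σ (i + 1) - σ i := fun i hi => sub_pos.2 (hn.lt_succ i hi)
  have hmem : ∀ i ≤ m, σ i ∈ Icc 0 S.T := by
    have mono : ∀ i j, i ≤ j → j ≤ m → σ i ≤ σ j := by
      intro i j hij
      induction j, hij using Nat.le_induction with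
      | base => exact fun _ => le_rfl
      | succ j _ ih => exact fun hj => (ih (by omega)).trans (hσ j (by omega))
    intro i hi
    rw [hI]
    exact ⟨mono 0 i (by omega) hi, mono i m hi le_rfl⟩
  have ysucc : ∀ i < m, y (σ (i + 1)) = w (i + 1) := fun i hi => by
    rw [hy i hi _ ⟨hσ i hi, le_rfl⟩, div_self (hpos i hi).ne', one_smul]; abel
  have incr : ∀ i < m, ∀ s ∈ Icc (σ i) (σ (i + 1)), ∀ t ∈ Icc (σ i) (σ (i + 1)),
      y t - y s = ((t - s) / (σ (i + 1) - σ i)) • (w (i + 1) - w i) := fun i hi s hs t ht => by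
    rw [hy i hi t ht, hy i hi s hs, add_sub_add_left_eq_sub, ← sub_smul, ← sub_div]
    congr 2; ring
  have lip : ∀ s ∈ Icc 0 S.T, ∀ t ∈ Icc 0 S.T, s ≤ t → ‖y t - y s‖ ≤ K * (t - s) := by
    intro s hs t ht hst
    rw [hI] at hs ht
    refine rel_of_rel_on_pieces (H := fun s t => ‖y t - y s‖ ≤ K * (t - s)) (fun t => by simp)
      (fun s u t _ _ h1 h2 => ?_) hσ (fun i hi s hs t ht hst => ?_) hs ht hst
    · have := norm_sub_le_norm_sub_add_norm_sub (y t) (y u) (y s)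
      linarith
    · have hp := hpos i hi
      rw [incr i hi s hs t ht, norm_smul,
        Real.norm_of_nonneg (div_nonneg (sub_nonneg.2 hst) hp.le), div_mul_eq_mul_div,
        div_le_iff₀ hp]
      have := mul_le_mul_of_nonneg_left (hn.norm_sub_le i hi) (sub_nonneg.2 hst)
      linarith
  have bound : ∀ t ∈ Icc 0 S.T, ‖y t‖ ≤ b := by
    intro t ht
    rw [hI] at ht
    obtain ⟨i, hi, hti⟩ := exists_mem_Icc_succ hm ht
    have hp := hpos i hi
    rw [hy i hi t hti, ← mem_closedBall_zero_iff]
    exact (convex_closedBall (0 : Z) b).add_smul_sub_mem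
      (mem_closedBall_zero_iff.2 (hn.norm_le i hi.le))
      (mem_closedBall_zero_iff.2 (hn.norm_le (i + 1) hi))
      ⟨div_nonneg (by linarith [hti.1]) hp.le, (div_le_one hp).2 (by linarith [hti.2])⟩
  -- Compares forces with the right end node, where the stability and dissipation of the step are
  -- known. Any earlier `s` is allowed, because the dissipation inequality freezes the force at a
  -- distant time.
  have shift : ∀ s ∈ Icc 0 S.T, ∀ i < m, s ≤ σ (i + 1) → ∀ v,
      |S.dEnergy s (y s) v - S.dEnergy (σ (i + 1)) (w (i + 1)) v| ≤
        Q * (σ (i + 1) - s) * ‖v‖ := by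
    intro s hs i hi hle v
    have h1 := h.abs_dEnergy_sub_le hΛ hs (hmem (i + 1) hi) (bound s hs)
      (hn.norm_le (i + 1) hi) v
    refine h1.trans ?_
    have h2 := lip s hs _ (hmem (i + 1) hi) hle
    rw [ysucc i hi, norm_sub_rev] at h2
    rw [abs_sub_comm, abs_of_nonneg (sub_nonneg.2 hle)]
    refine mul_le_mul_of_nonneg_right ?_ (norm_nonneg v)
    calc Λ * ‖y s - w (i + 1)‖ + L * c * (σ (i + 1) - s)
        ≤ Λ * (K * (σ (i + 1) - s)) + L * c * (σ (i + 1) - s) := by gcongr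
      _ = _ := by rw [hQ]; ring
  refine ⟨?_, bound, lip, fun t ht v => ?_, fun a ha t₀ ht₀ hat => ?_⟩
  · rw [← hn.σ_zero, hy 0 hm _ ⟨le_rfl, hσ 0 hm⟩, sub_self, zero_div, zero_smul, add_zero,
      hn.w_zero]
  · obtain ⟨i, hi, hti⟩ := exists_mem_Icc_succ hm (hI ▸ ht)
    have h1 := (abs_le.1 (shift t ht i hi hti.2 v)).1
    have h2 := hn.stable (i + 1) hi v
    have h3 : Q * (σ (i + 1) - t) * ‖v‖ ≤ (C + Q) * τ * ‖v‖ := by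
      have := hn.sub_le i hi
      have h4 : σ (i + 1) - t ≤ τ := by linarith [hti.1]
      have h5 : 0 ≤ σ (i + 1) - t := by linarith [hti.2]
      gcongr
      linarith
    linarith
  · have ha' := ha
    have ht₀' := ht₀
    rw [hI] at ha' ht₀'
    -- The base point `a` of the force and the length `t₀ - a` in the error are kept fixed; this
    -- makes the relation additive over pieces.
    refine rel_of_rel_on_pieces (H := fun s t => a ≤ s → t ≤ t₀ →
      S.diss (y t - y s) + S.dEnergy a (y a) (y t - y s) ≤
        ((C + Q) * τ + Q * (t₀ - a)) * (K * (t - s))) (fun t _ _ => by simp [h.diss_zero])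
      (fun s u t hsu hut h1 h2 has htt => ?_) hσ (fun i hi s hs t ht hst has htt => ?_)
      ha' ht₀' hat le_rfl le_rfl
    · have e1 := h1 has (hut.trans htt)
      have e2 := h2 (has.trans hsu) htt
      have e3 := h.diss_add_le (y t - y u) (y u - y s)
      have e4 : y t - y s = (y t - y u) + (y u - y s) := by abel
      rw [e4, map_add]
      linarith
    · have hp := hpos i hi
      set r := (t - s) / (σ (i + 1) - σ i) with hr
      have hr0 : 0 ≤ r := div_nonneg (sub_nonneg.2 hst) hp.le
      have hrh : r * (σ (i + 1) - σ i) = t - s := by rw [hr]; field_simp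
      set δ := w (i + 1) - w i with hδ
      have haσ : a ≤ σ (i + 1) := has.trans hs.2
      have e1 := (abs_le.1 (shift a ha i hi haσ δ)).2
      have e2 := hn.dissipation i hi
      have e3 := hn.norm_sub_le i hi
      have e4 := hn.sub_le i hi
      have e5 : σ (i + 1) - a ≤ t₀ - a + τ := by linarith [ht.1]
      have ta : 0 ≤ t₀ - a := sub_nonneg.2 hat
      rw [incr i hi s hs t ht, h.diss_smul _ hr0, map_smul, smul_eq_mul, ← mul_add]
      have e6 : S.diss δ + S.dEnergy a (y a) δ ≤
          (C * τ + Q * (t₀ - a + τ) * K) * (σ (i + 1) - σ i) := by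
        have f1 : Q * (σ (i + 1) - a) * ‖δ‖ ≤
            Q * (t₀ - a + τ) * (K * (σ (i + 1) - σ i)) := by gcongr
        have f2 : C * (σ (i + 1) - σ i) ^ 2 ≤ C * (τ * (σ (i + 1) - σ i)) := by
          rw [sq]; gcongr
        linarith
      have e7 := mul_le_mul_of_nonneg_left e6 hr0
      have ts : 0 ≤ t - s := sub_nonneg.2 hst
      have e8 : r * ((C * τ + Q * (t₀ - a + τ) * K) * (σ (i + 1) - σ i)) =
          (C * τ + Q * (t₀ - a + τ) * K) * (t - s) := by rw [← hrh]; ring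
      rw [e8] at e7
      refine e7.trans ?_
      have e9 : C * τ ≤ C * τ * K := le_mul_of_one_le_right (by positivity) hK
      calc (C * τ + Q * (t₀ - a + τ) * K) * (t - s)
          ≤ (C * τ * K + Q * (t₀ - a + τ) * K) * (t - s) := by gcongr
        _ = _ := by ring

end RateIndependentSystem

/-! ### Progress indices and the interpolant of the scheme. -/

/-- The enumeration of a finite set of natural numbers that contains `0`, with largest element `b`
and second largest element `a`. -/
theorem Nat.exists_nth_eq_of_largest {p : ℕ → Prop} {a b : ℕ} (h0 : p 0) (ha : p a) (hb : p b)
    (ha0 : 0 < a) (hab : a < b) (hle : ∀ k, p k → k ≤ b) (hgap : ∀ k, p k → a < k → k = b) :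
    ∃ m, 0 < m ∧ Nat.nth p 0 = 0 ∧ Nat.nth p m = a ∧ Nat.nth p (m + 1) = b ∧
      (∀ i, m + 1 < i → Nat.nth p i = 0) ∧ (∀ i ≤ m + 1, p (Nat.nth p i)) ∧
      (∀ i j, i < j → j ≤ m + 1 → Nat.nth p i < Nat.nth p j) ∧
      ∀ i ≤ m, ∀ k, Nat.nth p i < k → k < Nat.nth p (i + 1) → ¬ p k := by
  have hf : (Set.ofPred p).Finite := (Set.finite_Iic b).subset fun k hk => hle k hk
  set n := hf.toFinset.card with hn
  have mono : ∀ i j, i < j → j < n → Nat.nth p i < Nat.nth p j := fun i j hij hj =>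
    Nat.nth_lt_nth_of_lt_card hf hij hj
  have inj : ∀ i j, i < n → j < n → Nat.nth p i < Nat.nth p j → i < j := fun i j hi hj hlt => by
    by_contra hcon
    rcases (not_lt.1 hcon).eq_or_lt with rfl | h1
    · exact lt_irrefl _ hlt
    · exact lt_asymm hlt (mono j i h1 hi)
  have mem : ∀ i, i < n → p (Nat.nth p i) := fun i hi => Nat.nth_mem_of_lt_card hf hi
  obtain ⟨m, hm, hma⟩ := Nat.exists_lt_card_finite_nth_eq hf ha
  obtain ⟨l, hl, hlb⟩ := Nat.exists_lt_card_finite_nth_eq hf hb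
  have hz : Nat.nth p 0 = 0 := Nat.nth_zero_of_zero h0
  have hml : m < l := inj m l hm hl (by rw [hma, hlb]; exact hab)
  have hlm : l = m + 1 := by
    by_contra hne
    have h1 := mono m (m + 1) (by omega) (by omega)
    have h2 := mono (m + 1) l (by omega) hl
    rw [hma] at h1
    rw [hlb] at h2
    have := hgap _ (mem (m + 1) (by omega)) h1
    omega
  subst hlm
  have hnm : n = m + 2 := by
    by_contra hne
    have h1 := mono (m + 1) (m + 2) (by omega) (by omega)
    have h2 := hle _ (mem (m + 2) (by omega))
    omega
  refine ⟨m, ?_, hz, hma, hlb, fun i hi => Nat.nth_of_card_le hf (by omega),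
    fun i hi => mem i (by omega), fun i j hij hj => mono i j hij (by omega),
    fun i hi k h1 h2 hk => ?_⟩
  · rcases Nat.eq_zero_or_pos m with rfl | h
    · omega
    · exact h
  · obtain ⟨j, hj, rfl⟩ := Nat.exists_lt_card_finite_nth_eq hf hk
    have := inj i j (by omega) hj h1
    have := inj j (i + 1) hj (by omega) h2
    omega

namespace RateIndependentSystem

variable {Z V X : Type*}
  [NormedAddCommGroup Z] [InnerProductSpace ℝ Z]
  [NormedAddCommGroup V] [InnerProductSpace ℝ V]
  [NormedAddCommGroup X] [NormedSpace ℝ X]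
  {S : RateIndependentSystem Z V X} {κ L ρ c : ℝ}

namespace IsLocalMinScheme

variable {τ : ℝ} {t : ℕ → ℝ} {z : ℕ → Z}

theorem t_endIndex (hs : S.IsLocalMinScheme τ t z) (h : S.Regular κ L ρ c) (hτ : 0 < τ) :
    t (S.endIndex t) = S.T :=
  Nat.sInf_mem (s := {k | t k = S.T}) (hs.exists_t_eq h hτ)

theorem t_lt_of_lt_endIndex (hs : S.IsLocalMinScheme τ t z) (hT : 0 < S.T) {k : ℕ}
    (hk : k < S.endIndex t) : t k < S.T :=
  lt_of_le_of_ne (hs.t_mem hT k).2 (Nat.notMem_of_lt_sInf (s := {k | t k = S.T}) hk)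

theorem t_eq_of_endIndex_le (hs : S.IsLocalMinScheme τ t z) (h : S.Regular κ L ρ c) (hτ : 0 < τ)
    {k : ℕ} (hk : S.endIndex t ≤ k) : t k = S.T :=
  le_antisymm (hs.t_mem h.T_pos k).2 ((hs.t_endIndex h hτ).ge.trans (hs.t_monotone h.T_pos hk))

theorem endIndex_pos (hs : S.IsLocalMinScheme τ t z) (h : S.Regular κ L ρ c) (hτ : 0 < τ) :
    0 < S.endIndex t := by
  rcases Nat.eq_zero_or_pos (S.endIndex t) with h0 | hpos
  · have := hs.t_endIndex h hτ
    rw [h0, hs.t_zero] at this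
    exact absurd this h.T_pos.ne
  · exact hpos

theorem progress_endIndex (hs : S.IsLocalMinScheme τ t z) (h : S.Regular κ L ρ c) (hτ : 0 < τ) :
    t (S.endIndex t - 1) < t (S.endIndex t) := by
  rw [hs.t_endIndex h hτ]
  have := hs.endIndex_pos h hτ
  exact hs.t_lt_of_lt_endIndex h.T_pos (by omega)

theorem norm_eq_of_not_stable (hs : S.IsLocalMinScheme τ t z) (h : S.Regular κ L ρ c)
    (hS : S.Assumptions) (hτ : 0 < τ) {k : ℕ} (hk : S.endIndex t ≤ k)
    (hst : ¬ S.LocallyStable S.T (z (k + 1))) : ‖S.ι (z (k + 1) - z k)‖ = τ := by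
  by_contra hne
  refine hst ((hS.locallyStable_iff _ _).2 fun w => ?_)
  have h1 := hs.stable_up_to_multiplier h hτ (k + 1) w
  rw [hs.multiplier_eq_zero h hτ (lt_of_le_of_ne (hs.feasible k) hne), Nat.add_sub_cancel,
    hs.t_eq_of_endIndex_le h hτ hk] at h1
  simpa using h1

/-- After `T` is reached time no longer moves, and an unstable iterate has an active constraint,
since an inactive one gives a zero multiplier and thus stability. -/
theorem isStall_endIndex (hs : S.IsLocalMinScheme τ t z) (h : S.Regular κ L ρ c)
    (hS : S.Assumptions) (hτ : 0 < τ) {k₁ : ℕ} (hlt : S.endIndex t < k₁)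
    (hun : ∀ k, S.endIndex t < k → k < k₁ → ¬ S.LocallyStable S.T (z k)) :
    S.IsStall τ t z (S.endIndex t) k₁ :=
  ⟨hlt, hs.multiplier_eq_zero_of_progress h hτ (hs.progress_endIndex h hτ), fun k hk hk1 =>
    ⟨hs.norm_eq_of_not_stable h hS hτ hk (hun _ (by omega) hk1),
      (hs.t_eq_of_endIndex_le h hτ (by omega)).trans (hs.t_eq_of_endIndex_le h hτ hk).symm⟩⟩

/-- After the final time has been reached, a locally stable state is reached. -/
theorem exists_stable (hs : S.IsLocalMinScheme τ t z) (h : S.Regular κ L ρ c)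
    (hS : S.Assumptions) (hτ : 0 < τ) :
    ∃ k, S.endIndex t < k ∧ S.LocallyStable S.T (z k) := by
  by_contra! hun
  have h1 := (hs.isStall_endIndex h hS hτ
    (k₁ := S.endIndex t + (⌈L * c ^ 2 / κ⌉₊ + 1) + 1) (by omega)
    fun k hk _ => hun k hk).length_le hs h hτ
  omega

/-- The progress indices cut the iteration into stalls. -/
theorem exists_stalls (hs : S.IsLocalMinScheme τ t z) (h : S.Regular κ L ρ c)
    (hS : S.Assumptions) (hτ : 0 < τ) :
    ∃ m, 0 < m ∧ S.progressIndex t z 0 = 0 ∧ S.progressIndex t z m = S.endIndex t ∧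
      S.progressIndex t z (m + 1) = S.stableEndIndex t z ∧
      (∀ i, m + 1 < i → S.progressIndex t z i = 0) ∧
      (∀ i ≤ m, S.IsStall τ t z (S.progressIndex t z i) (S.progressIndex t z (i + 1))) ∧
      ∀ i < m, t (S.progressIndex t z (i + 1) - 1) < t (S.progressIndex t z (i + 1)) := by
  set N := S.endIndex t with hN
  set N' := S.stableEndIndex t z with hN'
  obtain ⟨hNN', -⟩ : N < N' ∧ S.LocallyStable S.T (z N') :=
    Nat.sInf_mem (s := {k | S.endIndex t < k ∧ S.LocallyStable S.T (z k)})
      (hs.exists_stable h hS hτ)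
  have hun : ∀ k, N < k → k < N' → ¬ S.LocallyStable S.T (z k) := fun k hk hk' hst =>
    Nat.notMem_of_lt_sInf (s := {k | S.endIndex t < k ∧ S.LocallyStable S.T (z k)}) hk' ⟨hk, hst⟩
  have hpos := hs.endIndex_pos h hτ
  have hprog := hs.progress_endIndex h hτ
  have hmem : ∀ k, k ∈ S.progressIndices t z ↔
      ((1 ≤ k ∧ k ≤ N) ∧ 0 < t k - t (k - 1)) ∨ (k = 0 ∨ k = N') := fun k => Iff.rfl
  obtain ⟨m, hm, k0, km, km', kout, kmem, kmono, kgap⟩ := Nat.exists_nth_eq_of_largest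
    (p := fun k => k ∈ S.progressIndices t z) (a := N) (b := N')
    ((hmem 0).2 (Or.inr (Or.inl rfl)))
    ((hmem N).2 (Or.inl ⟨⟨hpos, le_rfl⟩, sub_pos.2 hprog⟩)) ((hmem N').2 (Or.inr (Or.inr rfl)))
    hpos hNN' (fun k hk => by rcases (hmem k).1 hk with h1 | h1 <;> omega)
    (fun k hk hlt => by rcases (hmem k).1 hk with h1 | h1 <;> omega)
  have prog : ∀ i < m, t (S.progressIndex t z (i + 1) - 1) < t (S.progressIndex t z (i + 1)) := by
    intro i hi
    have h1 := kmono 0 (i + 1) (by omega) (by omega)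
    have h2 := kmono (i + 1) (m + 1) (by omega) (by omega)
    rcases (hmem _).1 (kmem (i + 1) (by omega)) with h3 | h3
    · exact sub_pos.1 h3.2
    · omega
  refine ⟨m, hm, k0, km, km', kout, fun i hi => ?_, prog⟩
  rcases hi.eq_or_lt with rfl | hlt
  · have e1 : S.progressIndex t z i = N := km
    have e2 : S.progressIndex t z (i + 1) = N' := km'
    rw [e1, e2]
    exact hs.isStall_endIndex h hS hτ hNN' hun
  · refine ⟨kmono i (i + 1) (by omega) (by omega), ?_, fun k hk hk1 => ?_⟩
    · cases i with
      | zero =>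
        have e : S.progressIndex t z 0 = 0 := k0
        rw [e]; rfl
      | succ i => exact hs.multiplier_eq_zero_of_progress h hτ (prog i (by omega))
    · have hkN : k + 1 < N := by
        have e1 : S.progressIndex t z m = N := km
        rcases (show i + 1 ≤ m from hlt).eq_or_lt with h1 | h1
        · rw [← e1, ← h1]; exact hk1
        · have : S.progressIndex t z (i + 1) < S.progressIndex t z m :=
            kmono (i + 1) m h1 (by omega)
          omega
      have hnp := kgap i hi (k + 1) (Nat.lt_succ_of_le hk) hk1
      have hle := hs.t_le_succ h.T_pos k
      have heq : t (k + 1) = t k := by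
        refine le_antisymm (not_lt.1 fun hlt' => hnp ?_) hle
        exact (hmem _).2 (Or.inl ⟨⟨by omega, hkN.le⟩, by
          rw [Nat.add_sub_cancel]; exact sub_pos.2 hlt'⟩)
      refine ⟨?_, heq⟩
      have h1 := hs.t_succ k
      have h2 := hs.t_lt_of_lt_endIndex h.T_pos hkN
      rcases min_choice (t k + τ - ‖S.ι (z (k + 1) - z k)‖) S.T with h3 | h3
      · rw [h3] at h1; linarith
      · rw [h3] at h1; exact absurd h1 h2.ne

theorem progressIndex_succ_le (hs : S.IsLocalMinScheme τ t z) (h : S.Regular κ L ρ c)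
    (hS : S.Assumptions) (hτ : 0 < τ) (i : ℕ) :
    S.progressIndex t z (i + 1) ≤ S.progressIndex t z i + (⌈L * c ^ 2 / κ⌉₊ + 1) := by
  obtain ⟨m, -, -, -, -, hout, hst, -⟩ := hs.exists_stalls h hS hτ
  rcases le_or_gt i m with hi | hi
  · exact (hst i hi).length_le hs h hτ
  -- Beyond the finite set `Nat.nth` has the default value `0`.
  · rw [hout (i + 1) (by omega)]
    exact Nat.zero_le _

/-- The interpolants of the scheme are Lipschitz continuous approximate solutions. -/
theorem isLipschitzApprox_interpolant (hs : S.IsLocalMinScheme τ t z) (h : S.Regular κ L ρ c)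
    (hS : S.Assumptions) (hτ : 0 < τ) {b Λ K : ℝ} (hΛ0 : 0 ≤ Λ) (hb : ∀ k, ‖z k‖ ≤ b)
    (hΛ : ∀ x ∈ Metric.closedBall (0 : Z) b, ∀ y ∈ Metric.closedBall (0 : Z) b, ∀ t v,
      |S.dEnergy t x v - S.dEnergy t y v| ≤ Λ * ‖x - y‖ * ‖v‖)
    (hK : K = (⌈L * c ^ 2 / κ⌉₊ + 1 : ℕ) * (c / κ * L) + 1) :
    S.IsLipschitzApprox ((Λ * K ^ 2 + (Λ * K + L * c)) * τ) b K (Λ * K + L * c)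
      (S.interpolant t z) := by
  obtain ⟨m, hm, k0, km, km', hout, hst, hprog⟩ := hs.exists_stalls h hS hτ
  have hc := h.c_pos
  have hκ := h.κ_pos
  have hL := h.L_nonneg
  set K₀ : ℝ := (⌈L * c ^ 2 / κ⌉₊ + 1 : ℕ) * (c / κ * L) with hK₀
  have hK₀0 : 0 ≤ K₀ := by positivity
  set q := S.progressIndex t z with hq
  -- Time is constant during a stall except for its last step, so the progress at a node is the full
  -- distance to the previous node.
  have tpred : ∀ i ≤ m, t (q (i + 1) - 1) = t (q i) := fun i hi => by
    have h1 := (hst i hi).lt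
    have h2 := (hst i hi).t_eq (j := q (i + 1) - 1 - q i) (by omega)
    rwa [show q i + (q (i + 1) - 1 - q i) = q (i + 1) - 1 by omega] at h2
  have tlt : ∀ i < m, t (q i) < t (q (i + 1)) := fun i hi => by
    rw [← tpred i hi.le]; exact hprog i hi
  have tq0 : t (q 0) = 0 := by rw [k0, hs.t_zero]
  have tqm : t (q m) = S.T := by rw [km, hs.t_endIndex h hτ]
  have stableEnd : S.LocallyStable S.T (z (S.stableEndIndex t z)) :=
    (Nat.sInf_mem (s := {k | S.endIndex t < k ∧ S.LocallyStable S.T (z k)})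
      (hs.exists_stable h hS hτ)).2
  -- The shift of indices matches each state with the time at which it is stable: `z (q (i + 1))`
  -- minimizes at time `t (q i)` with inactive constraint, and the last state is `z_{N̂}` at `T`. It
  -- starts at `z₀`, because the first stall is preceded by no time progress and so does not move.
  have node : S.IsNodeData τ b K (Λ * K ^ 2) m (fun i => t (q i)) (fun i => z (q (i + 1))) := by
    refine ⟨tq0, tqm, tlt, fun i hi => ?_, ?_, fun i _ => hb _, fun i hi => ?_, fun i hi v => ?_,
      fun i hi => ?_⟩
    · rw [← tpred i hi.le]
      exact hs.t_sub_pred_le hτ _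
    · have h1 := (hst 0 (by omega)).norm_sub_le_const hs h hτ
      rw [k0, Nat.zero_sub, sub_self, mul_zero, zero_add] at h1
      have h2 := norm_le_zero_iff.1 h1
      rw [sub_eq_zero, hs.z_zero] at h2
      exact h2
    · have h1 := (hst (i + 1) hi).norm_sub_le_const hs h hτ
      rw [tpred i hi.le, ← hK₀] at h1
      refine h1.trans ?_
      have := (tlt i hi).le
      rw [hK]
      gcongr
      linarith
    · rcases hi.eq_or_lt with rfl | hlt
      · have h1 := (hS.locallyStable_iff _ _).1 stableEnd v
        rw [tqm, km']
        exact h1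
      · have h1 := hs.stable_up_to_multiplier h hτ (q (i + 1)) v
        rw [(hst (i + 1) hlt).multiplier_eq, zero_mul, add_zero, tpred i hi] at h1
        exact h1
    · have h1 := (hst (i + 1) hi).dissipation_le_const hs h hτ hΛ0 hb hΛ
      rw [tpred i hi.le, ← hK₀] at h1
      refine h1.trans ?_
      gcongr
      rw [hK]; linarith
  have tmono : ∀ i j, i ≤ j → j ≤ m → t (q i) ≤ t (q j) := by
    intro i j hij
    induction j, hij using Nat.le_induction with
    | base => exact fun _ => le_rfl
    | succ j _ ih => exact fun hj => (ih (by omega)).trans (tlt j (by omega)).le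
  have formula : ∀ i < m, ∀ s, t (q i) ≤ s → s < t (q (i + 1)) → S.interpolant t z s =
      z (q (i + 1)) + ((s - t (q i)) / (t (q (i + 1)) - t (q i))) •
        (z (q (i + 1 + 1)) - z (q (i + 1))) := by
    intro i hi s hs1 hs2
    have hsT : s < S.T := hs2.trans_le (hs.t_mem h.T_pos _).2
    have hidx : S.intervalIndex t z s = i + 1 := by
      refine le_antisymm (Nat.sInf_le hs2) ?_
      refine le_csInf ⟨i + 1, hs2⟩ fun j hj => ?_
      by_contra hlt
      exact absurd (lt_of_lt_of_le hj (tmono j i (by omega) hi.le)) (not_lt.2 hs1)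
    simp only [interpolant, hidx, if_pos hsT, Nat.add_sub_cancel]
    rfl
  refine IsNodeData.isLipschitzApprox h (by positivity) (by rw [hK]; linarith) hΛ0 hτ hΛ node
    fun i hi s hsi => ?_
  rcases hsi.2.lt_or_eq with hlt | heq
  · exact formula i hi s hsi.1 hlt
  · have h1 : t (q (i + 1)) - t (q i) ≠ 0 := (sub_pos.2 (tlt i hi)).ne'
    rw [heq, div_self h1, one_smul, add_sub_cancel]
    rcases (show i + 1 ≤ m from hi).eq_or_lt with h2 | h2
    · subst h2
      rw [km', tqm]
      simp [interpolant]
    · rw [formula (i + 1) h2 _ le_rfl (tlt _ h2), sub_self, zero_div, zero_smul, add_zero]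

end IsLocalMinScheme

end RateIndependentSystem

theorem theorem3p15 {Z V X : Type*}
    [NormedAddCommGroup Z] [InnerProductSpace ℝ Z] [CompleteSpace Z]
    [NormedAddCommGroup V] [InnerProductSpace ℝ V] [CompleteSpace V]
    [NormedAddCommGroup X] [NormedSpace ℝ X] [CompleteSpace X]
    (S : RateIndependentSystem Z V X) (hS : S.Assumptions) (hconv : S.UniformlyConvex) :
    -- the scheme is well defined for every step size
    (∀ τ : ℝ, 0 < τ → ∃ (t : ℕ → ℝ) (z : ℕ → Z), S.IsLocalMinScheme τ t z) ∧
    -- there is a unique differential solution, and it is Lipschitz continuous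
    ∃ zsol : ℝ → Z, S.IsDifferentialSolution zsol ∧
      (∃ K : ℝ≥0, LipschitzOnWith K zsol (Icc 0 S.T)) ∧
      (∀ y : ℝ → Z, S.IsDifferentialSolution y → EqOn y zsol (Icc 0 S.T)) ∧
      -- constants that do not depend on the step size
      ∃ C : ℝ, 0 < C ∧ ∃ M : ℕ,
        ∀ (τ : ℝ) (t : ℕ → ℝ) (z : ℕ → Z), 0 < τ → S.IsLocalMinScheme τ t z →
          -- the final time and then a locally stable state are reached
          (∃ k, t k = S.T) ∧
          (∃ k, S.endIndex t < k ∧ S.LocallyStable S.T (z k)) ∧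
          -- stalls last a bounded number of steps
          (∀ i, S.progressIndex t z (i + 1) ≤ S.progressIndex t z i + M) ∧
          -- the error estimate
          ∀ s ∈ Icc 0 S.T, ‖zsol s - S.interpolant t z s‖ ≤ C * √τ := by
  obtain ⟨κ, L, ρ, c, h⟩ := hS.exists_regular hconv
  refine ⟨fun τ hτ => h.exists_scheme hτ, ?_⟩
  have hc := h.c_pos
  have hκ := h.κ_pos
  have hL := h.L_nonneg
  have hT := h.T_pos
  have hρ := h.ρ_nonneg
  set b := (ρ * c + L * S.T * c + ‖S.dEnergy 0 0‖ + L * c * S.T) / κ with hb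
  have hb0 : 0 ≤ b := by positivity
  obtain ⟨Λ, hΛ0, hΛ⟩ := h.lipschitz b
  obtain ⟨K, hK⟩ : ∃ K : ℝ, K = (⌈L * c ^ 2 / κ⌉₊ + 1 : ℕ) * (c / κ * L) + 1 := ⟨_, rfl⟩
  have hK0 : 0 ≤ K := by rw [hK]; positivity
  set Q := Λ * K + L * c with hQ
  have hQ0 : 0 ≤ Q := by positivity
  set D := Λ * K ^ 2 + Q with hD
  have hD0 : 0 ≤ D := by positivity
  -- The constants `b`, `K`, `Q`, `D` do not depend on `τ`; the error `D * τ` enters the comparison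
  -- linearly on the side of the squared distance, hence the rate `√τ`.
  have approx : ∀ (τ : ℝ) (t : ℕ → ℝ) (z : ℕ → Z), 0 < τ → S.IsLocalMinScheme τ t z →
      S.IsLipschitzApprox (D * τ) b K Q (S.interpolant t z) := fun τ t z hτ hs =>
    hs.isLipschitzApprox_interpolant h hS hτ hΛ0 (hs.norm_le h hτ) hΛ hK
  have hstep : ∀ n : ℕ, (0 : ℝ) < 1 / ((n : ℝ) + 1) := fun n => by positivity
  choose tn zn hn using fun n : ℕ => h.exists_scheme (hstep n)
  obtain ⟨zsol, hz⟩ := h.exists_limit hb0 hK0 hQ0 (ε := fun n : ℕ => D * (1 / ((n : ℝ) + 1)))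
    (fun n => by positivity)
    (by simpa using (tendsto_one_div_add_atTop_nhds_zero_nat (𝕜 := ℝ)).const_mul D)
    (fun n => approx _ _ _ (hstep n) (hn n))
  have hza := hz.isApproxSolution hK0 hQ0
  obtain ⟨C, hC, comp⟩ := h.exists_comparison hb0 hK0
  refine ⟨zsol, h.isDifferentialSolution hS hza, ⟨(⟨K, hK0⟩ : ℝ≥0), ?_⟩, fun y hy s hs => ?_,
    √(C * (D * (K * S.T + K * S.T))) + 1, by positivity, ⌈L * c ^ 2 / κ⌉₊ + 1,
    fun τ t z hτ hs => ⟨hs.exists_t_eq h hτ, hs.exists_stable h hS hτ,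
      hs.progressIndex_succ_le h hS hτ, fun s hsm => ?_⟩⟩
  · exact lipschitzOnWith_Icc_of_norm_sub_le fun s hs t ht => hz.norm_sub_le s hs t ht
  · obtain ⟨G, hG⟩ := hy.exists_isApproxSolution h hS (b := b) (by
      rw [hb]
      have : 0 ≤ L * S.T * c := by positivity
      gcongr
      linarith)
    have h1 := comp 0 0 G y zsol le_rfl le_rfl hG hza s hs
    rw [add_zero, zero_mul, mul_zero] at h1
    have h2 : ‖y s - zsol s‖ = 0 := by
      have := sq_nonneg ‖y s - zsol s‖
      exact pow_eq_zero_iff (two_ne_zero) |>.1 (le_antisymm h1 this)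
    exact sub_eq_zero.1 (norm_eq_zero.1 h2)
  · have h1 := comp 0 (D * τ) _ zsol _ le_rfl (by positivity) hza
      ((approx τ t z hτ hs).isApproxSolution hK0 hQ0) s hsm
    have h2 : C * ((0 + D * τ) * (K * S.T - K * 0 + K * S.T)) =
        C * (D * (K * S.T + K * S.T)) * τ := by ring
    rw [h2] at h1
    have h3 := Real.le_sqrt_of_sq_le h1
    rw [Real.sqrt_mul (by positivity)] at h3
    refine h3.trans ?_
    gcongr
    linarith
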